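/- Let $s\in(0,1)$, $\kappa\in\mathbb{R}$ and $\mu>0$. Let $\Lambda^{-s}$ be the Fourier multiplier operator on tempered distributions on $\mathbb{R}$ with symbol $(1+\xi^2)^{-s/2}$, where $\hat f(\xi)=\int_{\mathbb{R}}f(x)e^{-ix\xi}\,dx$. A solution of the steady fDP equation with wave speed $\mu$ is a bounded continuous function $\varphi\colon\mathbb{R}\to\mathbb{R}$ such that $$-\mu\varphi+\tfrac12\varphi^2+\tfrac32\Lambda^{-s}(\varphi^2)=\kappa\quad\text{on }\mathbb{R}.$$ Let $P\in(0,\infty]$, and let $\varphi$ be an even, nonconstant solution with $\varphi\le\mu$ on $\mathbb{R}$ and $\varphi(0)=\mu$, which is $P$-periodic if $P<\infty$ (no periodicity is required if $P=\infty$) and nondecreasing on $(-P/2,0)$. Then $\varphi\in C^{0,s}(\mathbb{R})$, that is, $\varphi$ is bounded and uniformly continuous and $$\sup_{x\ne y}\frac{|\varphi(x)-\varphi(y)|}{|x-y|^s}<\infty.$$ Moreover, there are constants $c,C,\delta>0$ such that $$c\,|x|^s\le\mu-\varphi(x)\le C\,|x|^s\qquad\text{for all }|x|<\delta.$$ -/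

import Mathlib

open scoped BoundedContinuousFunction SchwartzMap

noncomputable section

namespace SteadyFDP

/-- The symbol of the Bessel operator of order `-s`. With the normalization
`∫ f(x) exp(-i x ξ) dx` of the Fourier transform the symbol is `ξ ↦ (1 + ξ ^ 2) ^ (-s / 2)`;
Mathlib's Fourier transform is `∫ f(x) exp(-2 π i x ξ) dx`, which replaces the frequency `ξ` by
`2 π ξ`. -/
def besselSymbol (s : ℝ) (ξ : ℝ) : ℂ :=
  (((1 + (2 * Real.pi * ξ) ^ 2) ^ (-s / 2) : ℝ) : ℂ)

/-- The symbol is smooth with all derivatives of polynomial growth, so that it defines a Fourier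
multiplier on tempered distributions. -/
theorem besselSymbol_hasTemperateGrowth (s : ℝ) :
    (besselSymbol s).HasTemperateGrowth := by
  have h1 : (fun y : ℝ ↦ (1 + ‖y‖ ^ 2) ^ (-s / 2)).HasTemperateGrowth :=
    Function.hasTemperateGrowth_one_add_norm_sq_rpow ℝ (-s / 2)
  have h2 : (fun ξ : ℝ ↦ 2 * Real.pi * ξ).HasTemperateGrowth := by fun_prop
  have h3 := Function.Complex.hasTemperateGrowth_ofReal.comp (h1.comp h2)
  have h4 : besselSymbol s
      = Complex.ofReal ∘ ((fun y : ℝ ↦ (1 + ‖y‖ ^ 2) ^ (-s / 2)) ∘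
          fun ξ : ℝ ↦ 2 * Real.pi * ξ) := by
    funext ξ
    simp [besselSymbol, Real.norm_eq_abs, sq_abs]
  rw [h4]
  exact h3

/-- The Bessel operator of order `-s`, the Fourier multiplier with symbol `besselSymbol s`, acting
on tempered distributions. -/
def besselOp (s : ℝ) : 𝓢'(ℝ, ℂ) →L[ℂ] 𝓢'(ℝ, ℂ) :=
  TemperedDistribution.fourierMultiplierCLM ℂ (besselSymbol s)

theorem memLp_top_ofReal (f : ℝ →ᵇ ℝ) :
    MeasureTheory.MemLp (fun x ↦ (f x : ℂ)) ⊤ MeasureTheory.volume :=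
  MeasureTheory.memLp_top_of_bound
    (Complex.continuous_ofReal.comp f.continuous).aestronglyMeasurable ‖f‖
    (Filter.Eventually.of_forall fun x ↦ by
      simpa only [Complex.norm_real] using f.norm_coe_le_norm x)

/-- The tempered distribution `u ↦ ∫ u(x) f(x) dx` given by a bounded continuous real function. -/
def toDistribution (f : ℝ →ᵇ ℝ) : 𝓢'(ℝ, ℂ) :=
  MeasureTheory.Lp.toTemperedDistribution ((memLp_top_ofReal f).toLp (fun x ↦ (f x : ℂ)))

theorem toDistribution_apply (f : ℝ →ᵇ ℝ) (u : 𝓢(ℝ, ℂ)) :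
    toDistribution f u = ∫ x : ℝ, u x * (f x : ℂ) := by
  rw [toDistribution, MeasureTheory.Lp.toTemperedDistribution_apply]
  refine MeasureTheory.integral_congr_ae ?_
  filter_upwards [(memLp_top_ofReal f).coeFn_toLp] with x hx
  rw [hx, smul_eq_mul]

/-- `φ`, a bounded continuous real function, solves the steady fDP equation
`-μ φ + φ ^ 2 / 2 + (3 / 2) Λ φ ^ 2 = κ` at every point of the line, `Λ` being the Bessel operator
of order `-s`. Here `g` is the bounded continuous function (unique if it exists) that represents
the tempered distribution `Λ (φ ^ 2)`. -/
def IsSolution (s μ κ : ℝ) (φ : ℝ →ᵇ ℝ) : Prop :=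
  ∃ g : ℝ →ᵇ ℝ, toDistribution g = besselOp s (toDistribution (φ ^ 2)) ∧
    ∀ x : ℝ, -μ * φ x + 1 / 2 * φ x ^ 2 + 3 / 2 * g x = κ

/-- `φ` is `P`-periodic; there is no requirement in the solitary case `P = ∞`. -/
def IsPeriodic (P : EReal) (φ : ℝ → ℝ) : Prop :=
  ∀ T : ℝ, P = (T : EReal) → Function.Periodic φ T

/-- The interval `(-P / 2, 0)`, which is `(-∞, 0)` if `P = ∞`. -/
def leftHalfPeriod (P : EReal) : Set ℝ :=
  {x : ℝ | -(P / 2) < (x : EReal) ∧ x < 0}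

/-- The Hölder space of exponent `α ∈ (0, 1)` on the line: bounded, uniformly continuous functions
whose `α`-Hölder seminorm is finite. -/
def MemHolderSpace (α : ℝ) (f : ℝ → ℝ) : Prop :=
  UniformContinuous f ∧ (∃ M : ℝ, ∀ x : ℝ, |f x| ≤ M) ∧
    ∃ C : ℝ, ∀ x y : ℝ, |f x - f y| ≤ C * |x - y| ^ α

end SteadyFDP

end

noncomputable section

namespace SteadyFDP

open MeasureTheory Set

/-! ### The Bessel kernel as a superposition of exponentials -/

/-! For `0 < s < 1` the symbol `(1 + a ^ 2) ^ (-s / 2)` is a positive superposition of resolvents `1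
/ (σ + 1 + a ^ 2)`, so `Λ^{-s}` is convolution with a kernel `K` that is a positive superposition of
exponentials `exp (-√(1 + σ) |x|)`. Every kernel inequality is thereby reduced to one about `exp`
and `cosh`.

Put `u = μ - φ` and `w = μ ^ 2 - φ ^ 2`. Completing the square turns the equation into `u(x) ^ 2 = 3
(K ∗ w(x) - K ∗ w(0))`. A comparison argument gives `φ ≥ -μ`, so `0 ≤ w ≤ 2 μ u`; near the crest
also `w ≥ μ u`. Thus the square of `u` is governed by a convolution of something comparable to `u`,
and the exponent `s` is the fixed point of this relation.

Upper bound (`exists_abs_besselConv_sub_le_of_even`): for even `w` of size `N |z| ^ s`, the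
increment of `K ∗ w` from `0` to `x` is at most `C N |x| ^ (2 s)`. If `S` is the best constant in `u
≤ S |x| ^ s`, this reads `S ^ 2 ≤ C' S`.

Lower bound (`exists_le_besselConv_sub`): the second difference of `K` has mean zero and a single
sign change on `(0, x)`, and it is positive of size `x ^ 2 z ^ (s - 3)` beyond `x`. Since `w`
increases near `0`, the value `u(x) ^ 2` controls the growth of `w` at larger scales. A too small
value of `u` would then stay small along a geometric sequence of scales, up to a fixed scale where
`u` is known to be positive.

Hölder continuity: factor `u(x) ^ 2 - u(y) ^ 2` and divide by `u(x) + u(y)`. Near the crest the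
lower bound on `u(x)` cancels the factor `|x| ^ s` in the weighted estimate; away from it `u` is
bounded below. -/

/-- The density of the superposition. -/
def kernelWeight (s σ : ℝ) : ℝ := σ ^ (-s / 2) / (2 * √(1 + σ))

/-- The normalizing constant `(∫ σ ^ (-s / 2) / (σ + 1))⁻¹`, in Mathlib's notation for the integrand
of the integral representation of `x ^ p` with `p = 1 - s / 2`. -/
def kernelConst (s : ℝ) : ℝ := (∫ σ in Ioi 0, Real.rpowIntegrand₀₁ (1 - s / 2) σ 1)⁻¹

/-- The convolution kernel of the Bessel operator of order `-s`, for `0 < s < 1`. -/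
def besselKernel (s x : ℝ) : ℝ :=
  kernelConst s * ∫ σ in Ioi 0, kernelWeight s σ * Real.exp (-(√(1 + σ) * |x|))

theorem one_sub_half_mem {s : ℝ} (hs0 : 0 < s) (hs1 : s < 1) : 1 - s / 2 ∈ Ioo (0 : ℝ) 1 :=
  ⟨by linarith, by linarith⟩

theorem kernelConst_pos {s : ℝ} (hs0 : 0 < s) (hs1 : s < 1) : 0 < kernelConst s :=
  inv_pos.2 (Real.integral_rpowIntegrand₀₁_one_pos (one_sub_half_mem hs0 hs1))

theorem kernelWeight_pos (s : ℝ) {σ : ℝ} (hσ : 0 < σ) : 0 < kernelWeight s σ := by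
  unfold kernelWeight
  have := Real.rpow_pos_of_pos hσ (-s / 2)
  positivity

theorem measurable_kernelWeight (s : ℝ) : Measurable (kernelWeight s) := by
  unfold kernelWeight
  fun_prop

/-- Replacing `√(1 + σ)` by `√σ` leaves a Gamma integrand, which yields both integrability and the
singularity `y ^ (s - 1)` of the kernel. -/
theorem kernelWeight_mul_exp_le (s : ℝ) {σ y : ℝ} (hσ : 0 < σ) (hy : 0 ≤ y) :
    kernelWeight s σ * Real.exp (-(√(1 + σ) * y)) ≤
      1 / 2 * (σ ^ (-(s + 1) / 2) * Real.exp (-y * σ ^ (1 / 2 : ℝ))) := by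
  have h1 : √σ ≤ √(1 + σ) := Real.sqrt_le_sqrt (by linarith)
  have h2 : 0 < √σ := Real.sqrt_pos.2 hσ
  have h3 : kernelWeight s σ ≤ 1 / 2 * σ ^ (-(s + 1) / 2) := by
    have h4 : σ ^ (-(s + 1) / 2) = σ ^ (-s / 2) / √σ := by
      rw [Real.sqrt_eq_rpow, ← Real.rpow_sub hσ]
      ring_nf
    rw [h4, kernelWeight, div_mul_div_comm, one_mul]
    have := Real.rpow_pos_of_pos hσ (-s / 2)
    gcongr
  rw [← Real.sqrt_eq_rpow, ← mul_assoc]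
  have h5 : -(√(1 + σ) * y) ≤ -y * √σ := by nlinarith
  gcongr

theorem integrableOn_kernelWeight_mul_exp {s y : ℝ} (hs1 : s < 1) (hy : 0 < y) :
    IntegrableOn (fun σ ↦ kernelWeight s σ * Real.exp (-(√(1 + σ) * y))) (Ioi 0) := by
  have h := (integrableOn_rpow_mul_exp_neg_mul_rpow (p := 1 / 2) (s := -(s + 1) / 2) (b := y)
    (by linarith) (by norm_num) hy).const_mul (1 / 2)
  refine Integrable.mono' h ?_ ?_
  · have := measurable_kernelWeight s
    exact Measurable.aestronglyMeasurable (by fun_prop)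
  · filter_upwards [ae_restrict_mem measurableSet_Ioi] with σ hσ
    have hσ : 0 < σ := hσ
    have := kernelWeight_pos s hσ
    rw [Real.norm_of_nonneg (by positivity)]
    exact kernelWeight_mul_exp_le s hσ hy.le

theorem besselKernel_neg (s x : ℝ) : besselKernel s (-x) = besselKernel s x := by
  simp [besselKernel]

theorem besselKernel_of_pos (s : ℝ) {y : ℝ} (hy : 0 < y) : besselKernel s y =
    kernelConst s * ∫ σ in Ioi 0, kernelWeight s σ * Real.exp (-(√(1 + σ) * y)) := by
  rw [besselKernel, abs_of_pos hy]

theorem besselKernel_nonneg {s : ℝ} (hs0 : 0 < s) (hs1 : s < 1) (x : ℝ) :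
    0 ≤ besselKernel s x := by
  refine mul_nonneg (kernelConst_pos hs0 hs1).le (setIntegral_nonneg measurableSet_Ioi ?_)
  intro σ hσ
  have := kernelWeight_pos s hσ
  positivity

theorem exists_besselKernel_le {s : ℝ} (hs0 : 0 < s) (hs1 : s < 1) :
    ∃ C : ℝ, 0 < C ∧ ∀ y : ℝ, 0 < y → besselKernel s y ≤ C * y ^ (s - 1) := by
  have hc := kernelConst_pos hs0 hs1
  have hΓ : 0 < Real.Gamma (1 - s) := Real.Gamma_pos_of_pos (by linarith)
  refine ⟨kernelConst s * Real.Gamma (1 - s), by positivity, fun y hy ↦ ?_⟩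
  rw [besselKernel_of_pos s hy, mul_assoc]
  refine mul_le_mul_of_nonneg_left ?_ hc.le
  calc ∫ σ in Ioi 0, kernelWeight s σ * Real.exp (-(√(1 + σ) * y))
      ≤ ∫ σ in Ioi 0, 1 / 2 * (σ ^ (-(s + 1) / 2) * Real.exp (-y * σ ^ (1 / 2 : ℝ))) := by
        refine setIntegral_mono_on (integrableOn_kernelWeight_mul_exp hs1 hy)
          ((integrableOn_rpow_mul_exp_neg_mul_rpow (by linarith) (by norm_num) hy).const_mul _)
          measurableSet_Ioi fun σ hσ ↦ kernelWeight_mul_exp_le s hσ hy.le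
    _ = Real.Gamma (1 - s) * y ^ (s - 1) := by
        rw [integral_const_mul,
          integral_rpow_mul_exp_neg_mul_rpow (by norm_num) (by linarith) hy]
        have h1 : -(-(s + 1) / 2 + 1) / (1 / 2) = s - 1 := by ring
        have h2 : (-(s + 1) / 2 + 1) / (1 / 2) = 1 - s := by ring
        rw [h1, h2]
        ring

/-- Pointwise inequalities between combinations of exponentials give inequalities between the
corresponding combinations of values of the kernel. -/
theorem besselKernel_combination {s : ℝ} (hs1 : s < 1) {a b c d : ℝ} (p q r t : ℝ)
    (ha : 0 < a) (hb : 0 < b) (hc : 0 < c) (hd : 0 < d) :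
    IntegrableOn (fun σ ↦ kernelWeight s σ * (p * Real.exp (-(√(1 + σ) * a)) +
      q * Real.exp (-(√(1 + σ) * b)) + r * Real.exp (-(√(1 + σ) * c)) +
      t * Real.exp (-(√(1 + σ) * d)))) (Ioi 0) ∧
    p * besselKernel s a + q * besselKernel s b + r * besselKernel s c + t * besselKernel s d =
      kernelConst s * ∫ σ in Ioi 0, kernelWeight s σ * (p * Real.exp (-(√(1 + σ) * a)) +
      q * Real.exp (-(√(1 + σ) * b)) + r * Real.exp (-(√(1 + σ) * c)) +
      t * Real.exp (-(√(1 + σ) * d))) := by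
  have ia := (integrableOn_kernelWeight_mul_exp hs1 ha).const_mul p
  have ib := (integrableOn_kernelWeight_mul_exp hs1 hb).const_mul q
  have ic := (integrableOn_kernelWeight_mul_exp hs1 hc).const_mul r
  have id := (integrableOn_kernelWeight_mul_exp hs1 hd).const_mul t
  have h : (fun σ ↦ kernelWeight s σ * (p * Real.exp (-(√(1 + σ) * a)) +
      q * Real.exp (-(√(1 + σ) * b)) + r * Real.exp (-(√(1 + σ) * c)) +
      t * Real.exp (-(√(1 + σ) * d)))) = fun σ ↦
      p * (kernelWeight s σ * Real.exp (-(√(1 + σ) * a))) +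
      q * (kernelWeight s σ * Real.exp (-(√(1 + σ) * b))) +
      r * (kernelWeight s σ * Real.exp (-(√(1 + σ) * c))) +
      t * (kernelWeight s σ * Real.exp (-(√(1 + σ) * d))) := by
    funext σ
    ring
  rw [h]
  refine ⟨((ia.add ib).add ic).add id, ?_⟩
  have e1 := integral_add ((ia.add ib).add ic) id
  have e2 := integral_add (ia.add ib) ic
  have e3 := integral_add ia ib
  simp only [Pi.add_apply] at e1 e2 e3
  rw [e1, e2, e3]
  simp only [integral_const_mul, besselKernel_of_pos s ha, besselKernel_of_pos s hb,
    besselKernel_of_pos s hc, besselKernel_of_pos s hd]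
  ring

theorem besselKernel_combination_nonneg {s : ℝ} (hs0 : 0 < s) (hs1 : s < 1) {a b c d : ℝ}
    (p q r t : ℝ) (ha : 0 < a) (hb : 0 < b) (hc : 0 < c) (hd : 0 < d)
    (h : ∀ τ : ℝ, 0 < τ → 0 ≤ p * Real.exp (-(τ * a)) + q * Real.exp (-(τ * b)) +
      r * Real.exp (-(τ * c)) + t * Real.exp (-(τ * d))) :
    0 ≤ p * besselKernel s a + q * besselKernel s b + r * besselKernel s c +
      t * besselKernel s d := by
  rw [(besselKernel_combination hs1 p q r t ha hb hc hd).2]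
  refine mul_nonneg (kernelConst_pos hs0 hs1).le (setIntegral_nonneg measurableSet_Ioi ?_)
  intro σ hσ
  have hσ : 0 < σ := hσ
  exact mul_nonneg (kernelWeight_pos s hσ).le (h _ (by positivity))

theorem antitoneOn_besselKernel {s : ℝ} (hs0 : 0 < s) (hs1 : s < 1) :
    AntitoneOn (besselKernel s) (Ioi 0) := by
  intro a ha b hb hab
  have := besselKernel_combination_nonneg hs0 hs1 1 (-1) 0 0 ha hb ha ha (fun τ hτ ↦ by
    have : Real.exp (-(τ * b)) ≤ Real.exp (-(τ * a)) := by gcongr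
    linarith)
  linarith

/-! ### Symmetric differences of the kernel -/

/-- The second symmetric difference of the kernel. -/
def kernelDiff (s h z : ℝ) : ℝ :=
  besselKernel s (z + h) + besselKernel s (z - h) - 2 * besselKernel s z

theorem exp_add_exp_eq (τ z h : ℝ) : Real.exp (-(τ * (z + h))) + Real.exp (-(τ * (z - h))) =
    2 * Real.exp (-(τ * z)) * Real.cosh (τ * h) := by
  rw [Real.cosh_eq]
  have h1 : Real.exp (-(τ * (z + h))) = Real.exp (-(τ * z)) * Real.exp (-(τ * h)) := by
    rw [← Real.exp_add]; ring_nf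
  have h2 : Real.exp (-(τ * (z - h))) = Real.exp (-(τ * z)) * Real.exp (τ * h) := by
    rw [← Real.exp_add]; ring_nf
  rw [h1, h2]
  ring

theorem sq_div_two_le_cosh_sub_one (t : ℝ) : t ^ 2 / 2 ≤ Real.cosh t - 1 := by
  have h1 : Real.cosh t = 1 + 2 * Real.sinh (t / 2) ^ 2 := by
    have h := Real.cosh_two_mul (t / 2)
    have h' := Real.cosh_sq (t / 2)
    rw [mul_div_cancel₀ t two_ne_zero] at h
    linarith
  have h2 : (t / 2) ^ 2 ≤ Real.sinh (t / 2) ^ 2 := by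
    rw [sq_le_sq, Real.abs_sinh]
    exact Real.self_le_sinh_iff.2 (abs_nonneg _)
  rw [h1]
  nlinarith

/-- As `|h| < z`, the points `z ± h` are positive, so no absolute value intervenes and the
exponentials combine into `cosh`. The integrand is then visibly nonnegative. -/
theorem kernelDiff_eq {s : ℝ} (hs1 : s < 1) {h z : ℝ} (hz : |h| < z) :
    IntegrableOn (fun σ ↦ kernelWeight s σ *
      (2 * Real.exp (-(√(1 + σ) * z)) * (Real.cosh (√(1 + σ) * h) - 1))) (Ioi 0) ∧
    kernelDiff s h z = kernelConst s * ∫ σ in Ioi 0, kernelWeight s σ *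
      (2 * Real.exp (-(√(1 + σ) * z)) * (Real.cosh (√(1 + σ) * h) - 1)) := by
  have h0 : 0 < z := (abs_nonneg h).trans_lt hz
  have h1 := besselKernel_combination (s := s) hs1 (a := z + h) (b := z - h) (c := z) (d := z)
    1 1 (-2) 0 (by linarith [neg_abs_le h]) (by linarith [le_abs_self h]) h0 h0
  have h2 : (fun σ ↦ kernelWeight s σ *
      (2 * Real.exp (-(√(1 + σ) * z)) * (Real.cosh (√(1 + σ) * h) - 1))) =
      fun σ ↦ kernelWeight s σ * (1 * Real.exp (-(√(1 + σ) * (z + h))) +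
      1 * Real.exp (-(√(1 + σ) * (z - h))) + (-2) * Real.exp (-(√(1 + σ) * z)) +
      0 * Real.exp (-(√(1 + σ) * z))) := by
    funext σ
    have := exp_add_exp_eq (√(1 + σ)) z h
    rw [one_mul, one_mul, this]
    ring
  rw [h2]
  refine ⟨h1.1, ?_⟩
  rw [← h1.2, kernelDiff]
  ring

theorem kernelDiff_pos {s : ℝ} (hs0 : 0 < s) (hs1 : s < 1) {h z : ℝ} (hh : h ≠ 0)
    (hz : |h| < z) : 0 < kernelDiff s h z := by
  obtain ⟨h1, h2⟩ := kernelDiff_eq hs1 hz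
  rw [h2]
  refine mul_pos (kernelConst_pos hs0 hs1) ?_
  have hpos : ∀ σ ∈ Ioi (0 : ℝ), 0 < kernelWeight s σ *
      (2 * Real.exp (-(√(1 + σ) * z)) * (Real.cosh (√(1 + σ) * h) - 1)) := by
    intro σ hσ
    have hσ : 0 < σ := hσ
    have h3 := kernelWeight_pos s hσ
    have h4 : 0 < Real.cosh (√(1 + σ) * h) - 1 := by
      have : 1 < Real.cosh (√(1 + σ) * h) := Real.one_lt_cosh.2 (by positivity)
      linarith
    positivity
  rw [setIntegral_pos_iff_support_of_nonneg_ae _ h1]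
  · refine lt_of_lt_of_le (b := volume (Ioi (0 : ℝ))) (by simp) (measure_mono ?_)
    exact fun σ hσ ↦ ⟨(hpos σ hσ).ne', hσ⟩
  · filter_upwards [ae_restrict_mem measurableSet_Ioi] with σ hσ using (hpos σ hσ).le

theorem exists_le_kernelDiff {s : ℝ} (hs0 : 0 < s) (hs1 : s < 1) :
    ∃ c : ℝ, 0 < c ∧ ∀ h z : ℝ, |h| < z → z ≤ 1 → c * h ^ 2 * z ^ (s - 3) ≤ kernelDiff s h z := by
  have hc := kernelConst_pos hs0 hs1
  refine ⟨kernelConst s * (4 ^ (-s / 2) * Real.exp (-3) / 2 * 3), by positivity,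
    fun h z hz hz1 ↦ ?_⟩
  have h0 : 0 < z := (abs_nonneg h).trans_lt hz
  obtain ⟨h1, h2⟩ := kernelDiff_eq hs1 hz
  rw [h2, mul_assoc, mul_assoc]
  refine mul_le_mul_of_nonneg_left ?_ hc.le
  have hz2 : (1 : ℝ) ≤ 1 / z ^ 2 := by
    rw [le_div_iff₀ (by positivity)]
    nlinarith
  -- Only the frequencies at scale `1 / z` are kept. There `1 ≤ √(1 + σ) z ≤ 3`, the upper bound
  -- using `z ≤ 1`, and the interval has length `3 / z ^ 2`.
  have hsub : Ioc (1 / z ^ 2) (4 / z ^ 2) ⊆ Ioi 0 := fun σ hσ ↦ by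
    have := hσ.1
    exact lt_of_lt_of_le (by positivity) this.le
  have hpow : z ^ (s - 3) = (z ^ 2) ^ (s / 2) / z * (1 / z ^ 2) := by
    rw [← Real.rpow_natCast z 2, ← Real.rpow_mul h0.le]
    have h3 : ((2 : ℕ) : ℝ) * (s / 2) = s := by push_cast; ring
    rw [h3, Real.rpow_sub h0, show (3 : ℝ) = ((3 : ℕ) : ℝ) by norm_num, Real.rpow_natCast,
      Real.rpow_natCast]
    field_simp
  have key : ∀ σ ∈ Ioc (1 / z ^ 2) (4 / z ^ 2),
      4 ^ (-s / 2) * (z ^ 2) ^ (s / 2) * Real.exp (-3) / 2 * (h ^ 2 / z) ≤ kernelWeight s σ *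
      (2 * Real.exp (-(√(1 + σ) * z)) * (Real.cosh (√(1 + σ) * h) - 1)) := by
    intro σ hσ
    have hσ0 : 0 < σ := hsub hσ
    have h3 : 4 ^ (-s / 2) * (z ^ 2) ^ (s / 2) ≤ σ ^ (-s / 2) := by
      have : (4 : ℝ) ^ (-s / 2) * (z ^ 2) ^ (s / 2) = (4 / z ^ 2) ^ (-s / 2) := by
        rw [Real.div_rpow (by norm_num) (by positivity), neg_div,
          Real.rpow_neg (by positivity : (0 : ℝ) ≤ z ^ 2)]
        field_simp
      rw [this]
      exact Real.rpow_le_rpow_of_nonpos hσ0 hσ.2 (by linarith)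
    set τ := √(1 + σ) with hτ
    have hτ0 : 0 < τ := by positivity
    have h4 : 1 / z ≤ τ := by
      apply Real.le_sqrt_of_sq_le
      have := hσ.1
      rw [div_pow, one_pow]
      linarith
    have h5 : τ * z ≤ 3 := by
      have : τ ≤ 3 / z := by
        rw [hτ]
        apply Real.sqrt_le_iff.2 ⟨by positivity, ?_⟩
        have h6 := hσ.2
        have h7 : (3 / z) ^ 2 = 4 / z ^ 2 + 5 * (1 / z ^ 2) := by ring
        rw [h7]
        linarith
      calc τ * z ≤ 3 / z * z := by gcongr
        _ = 3 := by field_simp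
    have h6 : Real.exp (-3) ≤ Real.exp (-(τ * z)) := by gcongr
    have h7 := sq_div_two_le_cosh_sub_one (τ * h)
    have hw : kernelWeight s σ = σ ^ (-s / 2) / (2 * τ) := rfl
    calc 4 ^ (-s / 2) * (z ^ 2) ^ (s / 2) * Real.exp (-3) / 2 * (h ^ 2 / z)
        = 4 ^ (-s / 2) * (z ^ 2) ^ (s / 2) * (Real.exp (-3) * (h ^ 2 / 2 * (1 / z))) := by ring
      _ ≤ σ ^ (-s / 2) * (Real.exp (-(τ * z)) * (h ^ 2 / 2 * τ)) := by gcongr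
      _ = σ ^ (-s / 2) / (2 * τ) * (2 * Real.exp (-(τ * z)) * ((τ * h) ^ 2 / 2)) := by
        field_simp
      _ ≤ _ := by
        rw [hw]
        gcongr
  calc 4 ^ (-s / 2) * Real.exp (-3) / 2 * 3 * (h ^ 2 * z ^ (s - 3))
      = ∫ σ in Ioc (1 / z ^ 2) (4 / z ^ 2),
        4 ^ (-s / 2) * (z ^ 2) ^ (s / 2) * Real.exp (-3) / 2 * (h ^ 2 / z) := by
        rw [setIntegral_const, measureReal_def, Real.volume_Ioc, ENNReal.toReal_ofReal, hpow,
          smul_eq_mul]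
        · ring
        · rw [← sub_div]; norm_num; positivity
    _ ≤ ∫ σ in Ioc (1 / z ^ 2) (4 / z ^ 2), kernelWeight s σ *
      (2 * Real.exp (-(√(1 + σ) * z)) * (Real.cosh (√(1 + σ) * h) - 1)) :=
        setIntegral_mono_on (integrableOn_const (by simp)) (h1.mono_set hsub) measurableSet_Ioc key
    _ ≤ _ := by
        refine setIntegral_mono_set h1 ?_ hsub.eventuallyLE
        filter_upwards [ae_restrict_mem measurableSet_Ioi] with σ hσ
        have h3 := kernelWeight_pos s hσ
        have h4 := Real.one_le_cosh (√(1 + σ) * h)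
        have : 0 ≤ Real.cosh (√(1 + σ) * h) - 1 := by linarith
        simp only [Pi.zero_apply]
        positivity

/-- For `0 < z < h` evenness gives `K(h + z) + K(h - z) - 2 K(z)`. The first two terms are a
superposition of multiples of `cosh (τ z)`, hence increasing, and `-2 K` increases because `K`
decreases. -/
theorem kernelDiff_monotone {s : ℝ} (hs0 : 0 < s) (hs1 : s < 1) (h : ℝ) :
    MonotoneOn (kernelDiff s h) (Ioo 0 h) := by
  intro a ha b hb hab
  have e1 : ∀ z ∈ Ioo 0 h, besselKernel s (z - h) = besselKernel s (h - z) := fun z _ ↦ by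
    rw [← besselKernel_neg]; ring_nf
  have h1 : 0 < h := ha.1.trans ha.2
  have n1 := besselKernel_combination_nonneg hs0 hs1 1 1 (-1) (-1) (a := h + b) (b := h - b)
    (c := h + a) (d := h - a) (by linarith [hb.1]) (by linarith [hb.2]) (by linarith [ha.1])
    (by linarith [ha.2]) (fun τ hτ ↦ by
      have e2 := exp_add_exp_eq τ h a
      have e3 := exp_add_exp_eq τ h b
      have e4 : Real.cosh (τ * a) ≤ Real.cosh (τ * b) := by
        rw [Real.cosh_le_cosh, abs_of_pos (mul_pos hτ ha.1), abs_of_pos (mul_pos hτ hb.1)]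
        gcongr
      have e5 := Real.exp_pos (-(τ * h))
      nlinarith)
  have n2 := antitoneOn_besselKernel hs0 hs1 ha.1 hb.1 hab
  unfold kernelDiff
  rw [e1 a ha, e1 b hb, add_comm a h, add_comm b h]
  linarith

theorem abs_sinh_le (t : ℝ) : |Real.sinh t| ≤ |t| * Real.cosh t := by
  have h := Convex.norm_image_sub_le_of_norm_hasDerivWithin_le (f := Real.sinh) (f' := Real.cosh)
    (C := Real.cosh t) (s := Icc (-|t|) |t|) (x := 0) (y := t)
    (fun x _ ↦ (Real.hasDerivAt_sinh x).hasDerivWithinAt)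
    (fun x hx ↦ by
      rw [Real.norm_of_nonneg (Real.cosh_pos x).le, Real.cosh_le_cosh]
      exact abs_le.2 hx) (convex_Icc _ _)
    ⟨by simp, abs_nonneg t⟩ ⟨neg_abs_le t, le_abs_self t⟩
  simpa [mul_comm] using h

theorem abs_cosh_sub_cosh_le (a b : ℝ) : |Real.cosh a - Real.cosh b| ≤
    |a + b| * |a - b| / 4 * (Real.cosh a + Real.cosh b) := by
  have e1 : Real.cosh a - Real.cosh b = 2 * (Real.sinh ((a + b) / 2) * Real.sinh ((a - b) / 2)) := by
    have h1 := Real.cosh_add ((a + b) / 2) ((a - b) / 2)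
    have h2 := Real.cosh_sub ((a + b) / 2) ((a - b) / 2)
    rw [show (a + b) / 2 + (a - b) / 2 = a by ring] at h1
    rw [show (a + b) / 2 - (a - b) / 2 = b by ring] at h2
    linarith
  have e2 : Real.cosh a + Real.cosh b = 2 * (Real.cosh ((a + b) / 2) * Real.cosh ((a - b) / 2)) := by
    have h1 := Real.cosh_add ((a + b) / 2) ((a - b) / 2)
    have h2 := Real.cosh_sub ((a + b) / 2) ((a - b) / 2)
    rw [show (a + b) / 2 + (a - b) / 2 = a by ring] at h1
    rw [show (a + b) / 2 - (a - b) / 2 = b by ring] at h2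
    linarith
  rw [e1, e2, abs_mul, abs_mul, abs_two]
  have h1 := abs_sinh_le ((a + b) / 2)
  have h2 := abs_sinh_le ((a - b) / 2)
  rw [abs_div, abs_two] at h1 h2
  calc 2 * (|Real.sinh ((a + b) / 2)| * |Real.sinh ((a - b) / 2)|)
      ≤ 2 * ((|a + b| / 2 * Real.cosh ((a + b) / 2)) * (|a - b| / 2 * Real.cosh ((a - b) / 2))) := by
        gcongr
    _ = _ := by ring

/-- Symmetrizing cancels the first-order term, leaving the decay `z ^ (s - 3)` of a second
derivative. This gain makes the far part of the weighted estimate converge. -/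
theorem exists_abs_besselKernel_diff_le {s : ℝ} (hs0 : 0 < s) (hs1 : s < 1) :
    ∃ C : ℝ, 0 < C ∧ ∀ x y R z : ℝ, |x| ≤ R → |y| ≤ R → 0 < z → 2 * R ≤ z →
      |besselKernel s (z + x) + besselKernel s (z - x) -
        (besselKernel s (z + y) + besselKernel s (z - y))| ≤ C * |x - y| * R * z ^ (s - 3) := by
  obtain ⟨C, hC, hK⟩ := exists_besselKernel_le hs0 hs1
  refine ⟨64 * (C * 4 ^ (1 - s)), by positivity, fun x y R z hx hy hz0 hz ↦ ?_⟩
  have hR : 0 ≤ R := (abs_nonneg x).trans hx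
  have hx' := abs_le.1 hx
  have hy' := abs_le.1 hy
  set A := 64 * |x - y| * R / z ^ 2 with hA
  have hpt : ∀ τ : ℝ, 0 < τ → |Real.exp (-(τ * (z + x))) + Real.exp (-(τ * (z - x))) -
      (Real.exp (-(τ * (z + y))) + Real.exp (-(τ * (z - y))))| ≤ A * Real.exp (-(τ * (z / 4))) := by
    intro τ hτ
    rw [exp_add_exp_eq, exp_add_exp_eq, ← mul_sub, abs_mul, abs_of_pos (by positivity)]
    have h1 := abs_cosh_sub_cosh_le (τ * x) (τ * y)
    have hcosh : ∀ t : ℝ, |t| ≤ R → Real.cosh (τ * t) ≤ Real.exp (τ * R) := by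
      intro t ht
      rw [← Real.cosh_abs, abs_mul, abs_of_pos hτ]
      have h2 : Real.exp (-(τ * |t|)) ≤ Real.exp (τ * R) := by
        gcongr
        nlinarith [abs_nonneg t]
      have h3 : Real.exp (τ * |t|) ≤ Real.exp (τ * R) := by gcongr
      rw [Real.cosh_eq]
      linarith
    have h2 := hcosh x hx
    have h3 := hcosh y hy
    have h4 : |τ * x + τ * y| ≤ τ * (2 * R) := by
      rw [← mul_add, abs_mul, abs_of_pos hτ]
      gcongr
      exact (abs_add_le x y).trans (by linarith)
    have h5 : |τ * x - τ * y| = τ * |x - y| := by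
      rw [← mul_sub, abs_mul, abs_of_pos hτ]
    have h6 : |Real.cosh (τ * x) - Real.cosh (τ * y)| ≤ τ ^ 2 * R * |x - y| * Real.exp (τ * R) := by
      calc _ ≤ |τ * x + τ * y| * |τ * x - τ * y| / 4 *
            (Real.cosh (τ * x) + Real.cosh (τ * y)) := h1
        _ ≤ (τ * (2 * R)) * (τ * |x - y|) / 4 * (Real.exp (τ * R) + Real.exp (τ * R)) := by
          rw [h5]
          have := Real.cosh_pos (τ * x)
          have := Real.cosh_pos (τ * y)
          gcongr
        _ = _ := by ring
    -- The decay `exp (-τ z)` is spent in three parts: half absorbs `exp (τ R)`, a quarter absorbs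
    -- `τ ^ 2`, and the last quarter reproduces `K(z / 4)`.
    have h7 : τ ^ 2 ≤ 32 / z ^ 2 * Real.exp (τ * (z / 4)) := by
      have h8 := Real.quadratic_le_exp_of_nonneg (x := τ * (z / 4)) (by positivity)
      have h9 : (τ * (z / 4)) ^ 2 / 2 ≤ Real.exp (τ * (z / 4)) := by
        have : 0 < τ * (z / 4) := by positivity
        linarith
      calc τ ^ 2 = 32 / z ^ 2 * ((τ * (z / 4)) ^ 2 / 2) := by field_simp; norm_num
        _ ≤ _ := by gcongr
    calc 2 * Real.exp (-(τ * z)) * |Real.cosh (τ * x) - Real.cosh (τ * y)|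
        ≤ 2 * Real.exp (-(τ * z)) * (32 / z ^ 2 * Real.exp (τ * (z / 4)) * R * |x - y| *
          Real.exp (τ * (z / 2))) := by
          gcongr
          refine h6.trans ?_
          gcongr
          linarith
      _ = A * (Real.exp (-(τ * z)) * Real.exp (τ * (z / 4)) * Real.exp (τ * (z / 2))) := by
          rw [hA]; ring
      _ = A * Real.exp (-(τ * (z / 4))) := by
          rw [← Real.exp_add, ← Real.exp_add]
          ring_nf
  rcases hR.eq_or_lt with hR0 | hR0
  · have hx0 : x = 0 := by rw [← hR0] at hx; exact abs_nonpos_iff.1 hx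
    have hy0 : y = 0 := by rw [← hR0] at hy; exact abs_nonpos_iff.1 hy
    simp [hx0, hy0]
  have c1 := (besselKernel_combination hs1 1 1 (-1) (-1) (a := z + x) (b := z - x)
    (c := z + y) (d := z - y) (by linarith) (by linarith) (by linarith) (by linarith)).2
  have e1 : besselKernel s (z + x) + besselKernel s (z - x) -
        (besselKernel s (z + y) + besselKernel s (z - y)) = 1 * besselKernel s (z + x) +
      1 * besselKernel s (z - x) + (-1) * besselKernel s (z + y) +
      (-1) * besselKernel s (z - y) := by ring
  have hc := kernelConst_pos hs0 hs1
  have hz4 : 0 < z / 4 := by positivity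
  calc |besselKernel s (z + x) + besselKernel s (z - x) -
        (besselKernel s (z + y) + besselKernel s (z - y))|
      ≤ kernelConst s * ∫ σ in Ioi 0, A *
          (kernelWeight s σ * Real.exp (-(√(1 + σ) * (z / 4)))) := by
        rw [e1, c1, abs_mul, abs_of_pos hc, ← Real.norm_eq_abs]
        gcongr
        refine norm_integral_le_of_norm_le
          ((integrableOn_kernelWeight_mul_exp hs1 hz4).const_mul A) ?_
        filter_upwards [ae_restrict_mem measurableSet_Ioi] with σ hσ
        have hσ : 0 < σ := hσ
        have hw := kernelWeight_pos s hσ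
        rw [norm_mul, Real.norm_of_nonneg hw.le, Real.norm_eq_abs, mul_left_comm]
        refine mul_le_mul_of_nonneg_left (le_trans (le_of_eq ?_) (hpt _ (by positivity))) hw.le
        congr 1
        ring
    _ = A * besselKernel s (z / 4) := by
        rw [integral_const_mul, besselKernel_of_pos s hz4]
        ring
    _ ≤ A * (C * (z / 4) ^ (s - 1)) := by
        gcongr
        exact hK _ hz4
    _ = 64 * (C * 4 ^ (1 - s)) * |x - y| * R * z ^ (s - 3) := by
        rw [hA, Real.div_rpow hz0.le (by norm_num), show s - 3 = s - 1 - (2 : ℕ) by push_cast; ring,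
          Real.rpow_sub_natCast hz0.ne', show (1 - s) = -(s - 1) by ring,
          Real.rpow_neg (by norm_num : (0 : ℝ) ≤ 4)]
        field_simp

open scoped FourierTransform

/-! ### Integrability and the Fourier transform of the kernel -/

theorem integral_exp_neg_mul_abs {τ : ℝ} (hτ : 0 < τ) :
    ∫ y : ℝ, Real.exp (-(τ * |y|)) = 2 / τ := by
  rw [integral_comp_abs (f := fun y ↦ Real.exp (-(τ * y)))]
  have := integral_exp_mul_Ioi (a := -τ) (by linarith) 0
  simp only [neg_mul] at this
  rw [this]
  simp
  field_simp

theorem integrable_exp_neg_mul_abs {τ : ℝ} (hτ : 0 < τ) :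
    Integrable fun y : ℝ ↦ Real.exp (-(τ * |y|)) := by
  -- A non-integrable function has integral `0` by convention, so the nonzero value already computed
  -- proves integrability.
  refine not_imp_comm.1 integral_undef ?_
  rw [integral_exp_neg_mul_abs hτ]
  positivity

theorem integral_exp_neg_mul_abs_mul_cexp {τ : ℝ} (hτ : 0 < τ) (a : ℝ) :
    ∫ y : ℝ, (Real.exp (-(τ * |y|)) : ℂ) * Complex.exp (a * y * Complex.I) =
      ((2 * τ / (τ ^ 2 + a ^ 2) : ℝ) : ℂ) := by
  have hint : Integrable fun y : ℝ ↦
      (Real.exp (-(τ * |y|)) : ℂ) * Complex.exp (a * y * Complex.I) := by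
    refine Integrable.mul_bdd (c := 1) (integrable_exp_neg_mul_abs hτ).ofReal
      (Continuous.aestronglyMeasurable (by fun_prop)) (Filter.Eventually.of_forall fun y ↦ ?_)
    rw [← Complex.ofReal_mul, Complex.norm_exp_ofReal_mul_I]
  rw [← intervalIntegral.integral_Iic_add_Ioi (b := 0) hint.integrableOn hint.integrableOn]
  have h1 : ∫ y in Iic (0 : ℝ), (Real.exp (-(τ * |y|)) : ℂ) * Complex.exp (a * y * Complex.I) =
      1 / (τ + a * Complex.I) := by
    have := integral_exp_mul_complex_Iic (a := τ + a * Complex.I) (by simpa using hτ) 0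
    simp only [Complex.ofReal_zero, mul_zero, Complex.exp_zero] at this
    rw [← this]
    refine setIntegral_congr_fun measurableSet_Iic fun y hy ↦ ?_
    simp only [abs_of_nonpos (show y ≤ 0 from hy)]
    rw [Complex.ofReal_exp, ← Complex.exp_add]
    push_cast
    ring_nf
  have h2 : ∫ y in Ioi (0 : ℝ), (Real.exp (-(τ * |y|)) : ℂ) * Complex.exp (a * y * Complex.I) =
      1 / (τ - a * Complex.I) := by
    have := integral_exp_mul_complex_Ioi (a := -τ + a * Complex.I) (by simpa using hτ) 0
    simp only [Complex.ofReal_zero, mul_zero, Complex.exp_zero] at this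
    rw [show (1 : ℂ) / (τ - a * Complex.I) = -1 / (-τ + a * Complex.I) by
      rw [← neg_div_neg_eq]; ring_nf, ← this]
    refine setIntegral_congr_fun measurableSet_Ioi fun y hy ↦ ?_
    simp only [abs_of_pos (show 0 < y from hy)]
    rw [Complex.ofReal_exp, ← Complex.exp_add]
    push_cast
    ring_nf
  have n1 : (τ + a * Complex.I : ℂ) ≠ 0 := fun h ↦ hτ.ne' (by simpa using congrArg Complex.re h)
  have n2 : (τ - a * Complex.I : ℂ) ≠ 0 := fun h ↦ hτ.ne' (by simpa using congrArg Complex.re h)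
  have n3 : ((τ : ℂ) ^ 2 + (a : ℂ) ^ 2) = (τ + a * Complex.I) * (τ - a * Complex.I) := by
    ring_nf
    simp
  rw [h1, h2]
  push_cast
  rw [n3]
  field_simp
  ring

/-- The second factor is the Fourier transform of `exp (-√(1 + σ) |y|)` at `a`. Integrating over `σ`
therefore gives the integral formula for `(1 + a ^ 2) ^ (1 - s / 2)`, divided by `1 + a ^ 2`. -/
theorem kernelWeight_mul_eq {s σ : ℝ} (hs0 : 0 < s) (hs1 : s < 1) (hσ : 0 < σ) (a : ℝ) :
    kernelWeight s σ * (2 * √(1 + σ) / (√(1 + σ) ^ 2 + a ^ 2)) =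
      (1 + a ^ 2)⁻¹ * Real.rpowIntegrand₀₁ (1 - s / 2) σ (1 + a ^ 2) := by
  rw [Real.rpowIntegrand₀₁_eq_pow_div (one_sub_half_mem hs0 hs1) hσ.le (by positivity),
    kernelWeight, Real.sq_sqrt (by positivity), show 1 - s / 2 - 1 = -s / 2 by ring]
  have : √(1 + σ) ≠ 0 := by positivity
  have : (1 + a ^ 2) ≠ 0 := by positivity
  rw [show σ + (1 + a ^ 2) = 1 + σ + a ^ 2 by ring]
  field_simp

theorem integrable_kernel_prod {s : ℝ} (hs0 : 0 < s) (hs1 : s < 1) :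
    Integrable (fun p : ℝ × ℝ ↦ kernelWeight s p.1 * Real.exp (-(√(1 + p.1) * |p.2|)))
      ((volume.restrict (Ioi 0)).prod volume) := by
  have hm : Measurable fun p : ℝ × ℝ ↦
      kernelWeight s p.1 * Real.exp (-(√(1 + p.1) * |p.2|)) := by
    have := measurable_kernelWeight s
    have h : Measurable fun p : ℝ × ℝ ↦ |p.2| := by fun_prop
    fun_prop
  rw [integrable_prod_iff hm.aestronglyMeasurable]
  constructor
  · filter_upwards [ae_restrict_mem measurableSet_Ioi] with σ hσ
    have hσ : 0 < σ := hσ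
    exact (integrable_exp_neg_mul_abs (by positivity)).const_mul _
  · refine (Real.integrableOn_rpowIntegrand₀₁_Ioi (one_sub_half_mem hs0 hs1)
      zero_le_one).congr_fun (fun σ hσ ↦ ?_) measurableSet_Ioi
    have hσ : 0 < σ := hσ
    have hw := kernelWeight_pos s hσ
    have h := kernelWeight_mul_eq hs0 hs1 hσ 0
    simp only [norm_mul, Real.norm_eq_abs, Real.abs_exp, abs_of_pos hw]
    rw [integral_const_mul, integral_exp_neg_mul_abs (by positivity)]
    have : √(1 + σ) ≠ 0 := by positivity
    have e : 2 * √(1 + σ) / √(1 + σ) ^ 2 = 2 / √(1 + σ) := by field_simp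
    simpa [e] using h.symm

theorem integrable_besselKernel {s : ℝ} (hs0 : 0 < s) (hs1 : s < 1) :
    Integrable (besselKernel s) :=
  (integrable_kernel_prod hs0 hs1).integral_prod_right.const_mul (kernelConst s)

theorem integral_besselKernel_mul_cexp {s : ℝ} (hs0 : 0 < s) (hs1 : s < 1) (a : ℝ) :
    ∫ y : ℝ, (besselKernel s y : ℂ) * Complex.exp (a * y * Complex.I) =
      (((1 + a ^ 2) ^ (-s / 2) : ℝ) : ℂ) := by
  have hc := kernelConst_pos hs0 hs1
  have hint : Integrable (Function.uncurry fun σ y : ℝ ↦ ((kernelWeight s σ : ℂ) *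
      (Real.exp (-(√(1 + σ) * |y|)) : ℂ)) * Complex.exp (a * y * Complex.I))
      ((volume.restrict (Ioi 0)).prod volume) := by
    refine Integrable.mul_bdd (c := 1) (f := fun p : ℝ × ℝ ↦ (kernelWeight s p.1 : ℂ) *
      (Real.exp (-(√(1 + p.1) * |p.2|)) : ℂ)) (by simpa using (integrable_kernel_prod hs0 hs1).ofReal (𝕜 := ℂ))
      (Continuous.aestronglyMeasurable (by fun_prop)) (Filter.Eventually.of_forall fun p ↦ ?_)
    rw [← Complex.ofReal_mul, Complex.norm_exp_ofReal_mul_I]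
  have h1 : ∀ y : ℝ, (besselKernel s y : ℂ) * Complex.exp (a * y * Complex.I) =
      kernelConst s * ∫ σ in Ioi 0, ((kernelWeight s σ : ℂ) *
      (Real.exp (-(√(1 + σ) * |y|)) : ℂ)) * Complex.exp (a * y * Complex.I) := by
    intro y
    rw [integral_mul_const, ← mul_assoc, besselKernel, Complex.ofReal_mul,
      ← integral_complex_ofReal]
    simp only [Complex.ofReal_mul]
  simp only [h1]
  rw [integral_const_mul, ← integral_integral_swap hint]
  have h2 : ∀ σ ∈ Ioi (0 : ℝ), ∫ y : ℝ, ((kernelWeight s σ : ℂ) *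
      (Real.exp (-(√(1 + σ) * |y|)) : ℂ)) * Complex.exp (a * y * Complex.I) =
      (((1 + a ^ 2)⁻¹ * Real.rpowIntegrand₀₁ (1 - s / 2) σ (1 + a ^ 2) : ℝ) : ℂ) := by
    intro σ hσ
    have hσ : 0 < σ := hσ
    simp only [mul_assoc]
    rw [integral_const_mul]
    have := integral_exp_neg_mul_abs_mul_cexp (τ := √(1 + σ)) (by positivity) a
    simp only [mul_assoc] at this
    rw [this, ← Complex.ofReal_mul, ← kernelWeight_mul_eq hs0 hs1 hσ]
  rw [setIntegral_congr_fun measurableSet_Ioi h2, integral_complex_ofReal, ← Complex.ofReal_mul,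
    integral_const_mul, Real.integral_rpowIntegrand₀₁_eq_rpow_mul_const
      (one_sub_half_mem hs0 hs1) (by positivity), kernelConst]
  have hne := (Real.integral_rpowIntegrand₀₁_one_pos (one_sub_half_mem hs0 hs1)).ne'
  congr 1
  have e : (1 + a ^ 2) ^ (1 - s / 2) = (1 + a ^ 2) * (1 + a ^ 2) ^ (-s / 2) := by
    rw [show 1 - s / 2 = 1 + -s / 2 by ring, Real.rpow_add (by positivity), Real.rpow_one]
  rw [e]
  have : 1 + a ^ 2 ≠ 0 := by positivity
  set I := ∫ t in Ioi 0, Real.rpowIntegrand₀₁ (1 - s / 2) t 1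
  field_simp

/-! ### The Bessel operator as a convolution -/

/-- Convolution with the Bessel kernel. -/
def besselConv (s : ℝ) (w : ℝ → ℝ) (x : ℝ) : ℝ := ∫ y, besselKernel s y * w (x - y)

theorem integrable_besselKernel_mul {s : ℝ} (hs0 : 0 < s) (hs1 : s < 1) {w : ℝ → ℝ}
    (hw : Continuous w) {M : ℝ} (hM : ∀ x, |w x| ≤ M) :
    Integrable fun y ↦ besselKernel s y * w y :=
  (integrable_besselKernel hs0 hs1).mul_bdd (c := M) hw.aestronglyMeasurable
    (Filter.Eventually.of_forall hM)

theorem continuous_besselConv {s : ℝ} (hs0 : 0 < s) (hs1 : s < 1) {w : ℝ → ℝ}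
    (hw : Continuous w) {M : ℝ} (hM : ∀ x, |w x| ≤ M) : Continuous (besselConv s w) := by
  refine continuous_of_dominated (bound := fun y ↦ besselKernel s y * M) ?_ ?_
    ((integrable_besselKernel hs0 hs1).mul_const M) ?_
  · exact fun x ↦ (integrable_besselKernel_mul hs0 hs1 (w := fun y ↦ w (x - y)) (by fun_prop)
      (fun y ↦ hM _)).aestronglyMeasurable
  · refine fun x ↦ Filter.Eventually.of_forall fun y ↦ ?_
    rw [norm_mul, Real.norm_of_nonneg (besselKernel_nonneg hs0 hs1 y)]
    exact mul_le_mul_of_nonneg_left (hM _) (besselKernel_nonneg hs0 hs1 y)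
  · exact Filter.Eventually.of_forall fun y ↦ by fun_prop

theorem abs_besselConv_le {s : ℝ} (hs0 : 0 < s) (hs1 : s < 1) {w : ℝ → ℝ} {M : ℝ}
    (hM : ∀ x, |w x| ≤ M) (x : ℝ) : |besselConv s w x| ≤ (∫ y, besselKernel s y) * M := by
  rw [← integral_mul_const, ← Real.norm_eq_abs, besselConv]
  refine norm_integral_le_of_norm_le ((integrable_besselKernel hs0 hs1).mul_const M)
    (Filter.Eventually.of_forall fun y ↦ ?_)
  rw [norm_mul, Real.norm_of_nonneg (besselKernel_nonneg hs0 hs1 y)]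
  exact mul_le_mul_of_nonneg_left (hM _) (besselKernel_nonneg hs0 hs1 y)

/-- Convolution with the Bessel kernel as an operation on bounded continuous functions. -/
def besselConvBCF {s : ℝ} (hs0 : 0 < s) (hs1 : s < 1) (v : ℝ →ᵇ ℝ) : ℝ →ᵇ ℝ :=
  BoundedContinuousFunction.ofNormedAddCommGroup (besselConv s v)
    (continuous_besselConv hs0 hs1 v.continuous v.norm_coe_le_norm)
    ((∫ y, besselKernel s y) * ‖v‖) (abs_besselConv_le hs0 hs1 v.norm_coe_le_norm)

theorem fourierMultiplier_besselSymbol_apply {s : ℝ} (hs0 : 0 < s) (hs1 : s < 1) (u : 𝓢(ℝ, ℂ))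
    (x : ℝ) : 𝓕 (SchwartzMap.smulLeftCLM ℂ (besselSymbol s) (𝓕⁻ u)) x =
      ∫ y : ℝ, (besselKernel s y : ℂ) * u (x - y) := by
  set U : 𝓢(ℝ, ℂ) := 𝓕⁻ u with hU
  have hu : ∀ z : ℝ, u z = ∫ ξ : ℝ, Complex.exp ((-2 * Real.pi * (z * ξ) : ℝ) * Complex.I) * U ξ := by
    intro z
    have h : u = 𝓕 U := (FourierTransform.fourier_fourierInv_eq u).symm
    rw [h, SchwartzMap.fourier_coe, Real.fourier_eq']
    refine integral_congr_ae (Filter.Eventually.of_forall fun ξ ↦ ?_)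
    simp [mul_assoc]
  rw [SchwartzMap.fourier_coe, Real.fourier_eq']
  simp only [SchwartzMap.smulLeftCLM_apply_apply (besselSymbol_hasTemperateGrowth s), smul_eq_mul]
  have hm : ∀ ξ : ℝ, besselSymbol s ξ =
      ∫ y : ℝ, (besselKernel s y : ℂ) * Complex.exp (((2 * Real.pi * ξ : ℝ) : ℂ) * y * Complex.I) :=
    fun ξ ↦ (integral_besselKernel_mul_cexp hs0 hs1 _).symm
  have hint : Integrable (Function.uncurry fun ξ y : ℝ ↦ U ξ * (besselKernel s y : ℂ) *
      Complex.exp ((-2 * Real.pi * ((x - y) * ξ) : ℝ) * Complex.I)) (volume.prod volume) := by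
    refine Integrable.mul_bdd (c := 1) (f := fun p : ℝ × ℝ ↦ U p.1 * (besselKernel s p.2 : ℂ))
      (U.integrable.mul_prod (integrable_besselKernel hs0 hs1).ofReal)
      (Continuous.aestronglyMeasurable (by fun_prop)) (Filter.Eventually.of_forall fun p ↦ ?_)
    rw [Complex.norm_exp_ofReal_mul_I]
  calc _ = ∫ ξ : ℝ, ∫ y : ℝ, U ξ * (besselKernel s y : ℂ) *
      Complex.exp ((-2 * Real.pi * ((x - y) * ξ) : ℝ) * Complex.I) := by
        refine integral_congr_ae (Filter.Eventually.of_forall fun ξ ↦ ?_)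
        simp only
        rw [hm, ← integral_mul_const, ← integral_const_mul]
        refine integral_congr_ae (Filter.Eventually.of_forall fun y ↦ ?_)
        simp only [RCLike.inner_apply, conj_trivial]
        have : Complex.exp ((-2 * Real.pi * ((x - y) * ξ) : ℝ) * Complex.I) =
          Complex.exp ((-2 * Real.pi * (x * ξ) : ℝ) * Complex.I) *
          Complex.exp (((2 * Real.pi * ξ : ℝ) : ℂ) * y * Complex.I) := by
          rw [← Complex.exp_add]
          push_cast
          ring_nf
        rw [this]
        ring
    _ = ∫ y : ℝ, ∫ ξ : ℝ, U ξ * (besselKernel s y : ℂ) *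
      Complex.exp ((-2 * Real.pi * ((x - y) * ξ) : ℝ) * Complex.I) := integral_integral_swap hint
    _ = _ := by
        refine integral_congr_ae (Filter.Eventually.of_forall fun y ↦ ?_)
        simp only
        rw [hu, ← integral_const_mul]
        refine integral_congr_ae (Filter.Eventually.of_forall fun ξ ↦ ?_)
        simp only
        ring

/-- The multiplier acts on the test function by transposition. Fubini and the evenness of `K` move
the convolution onto `v`. -/
theorem besselOp_toDistribution {s : ℝ} (hs0 : 0 < s) (hs1 : s < 1) (v : ℝ →ᵇ ℝ) :
    besselOp s (toDistribution v) = toDistribution (besselConvBCF hs0 hs1 v) := by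
  ext u
  rw [besselOp, TemperedDistribution.fourierMultiplierCLM_apply_apply, toDistribution_apply,
    toDistribution_apply]
  simp only [fourierMultiplier_besselSymbol_apply hs0 hs1]
  have hK := (integrable_besselKernel hs0 hs1).ofReal (𝕜 := ℂ)
  have hvb : ∀ z : ℝ, ‖(v z : ℂ)‖ ≤ ‖v‖ := fun z ↦ by
    rw [Complex.norm_real]
    exact v.norm_coe_le_norm z
  have i1 : Integrable (Function.uncurry fun x y : ℝ ↦
      (besselKernel s y : ℂ) * u (x - y) * (v x : ℂ)) (volume.prod volume) := by
    refine Integrable.mul_bdd (c := ‖v‖)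
      (f := fun p : ℝ × ℝ ↦ (besselKernel s p.2 : ℂ) * u (p.1 - p.2))
      (Integrable.convolution_integrand (ContinuousLinearMap.mul ℂ ℂ) hK u.integrable)
      (Continuous.aestronglyMeasurable ?_) (Filter.Eventually.of_forall fun p ↦ hvb _)
    have := v.continuous
    fun_prop
  have i2 : Integrable (Function.uncurry fun y x : ℝ ↦
      (besselKernel s y : ℂ) * u x * (v (x - y) : ℂ)) (volume.prod volume) := by
    refine Integrable.mul_bdd (c := ‖v‖)
      (f := fun p : ℝ × ℝ ↦ (besselKernel s p.1 : ℂ) * u p.2) (hK.mul_prod u.integrable)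
      (Continuous.aestronglyMeasurable ?_) (Filter.Eventually.of_forall fun p ↦ hvb _)
    have := v.continuous
    fun_prop
  calc ∫ x : ℝ, (∫ y : ℝ, (besselKernel s y : ℂ) * u (x - y)) * (v x : ℂ)
      = ∫ x : ℝ, ∫ y : ℝ, (besselKernel s y : ℂ) * u (x - y) * (v x : ℂ) := by
        simp only [integral_mul_const]
    _ = ∫ y : ℝ, ∫ x : ℝ, (besselKernel s y : ℂ) * u (x - y) * (v x : ℂ) :=
        integral_integral_swap i1
    _ = ∫ y : ℝ, ∫ x : ℝ, (besselKernel s y : ℂ) * u x * (v (x + y) : ℂ) := by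
        refine integral_congr_ae (Filter.Eventually.of_forall fun y ↦ ?_)
        simp only
        rw [← integral_add_right_eq_self _ y]
        simp
    _ = ∫ y : ℝ, ∫ x : ℝ, (besselKernel s y : ℂ) * u x * (v (x - y) : ℂ) := by
        rw [← integral_neg_eq_self]
        simp only [besselKernel_neg, sub_eq_add_neg]
    _ = ∫ x : ℝ, ∫ y : ℝ, (besselKernel s y : ℂ) * u x * (v (x - y) : ℂ) :=
        integral_integral_swap i2
    _ = _ := by
        refine integral_congr_ae (Filter.Eventually.of_forall fun x ↦ ?_)
        simp only [besselConvBCF, BoundedContinuousFunction.coe_ofNormedAddCommGroup, besselConv]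
        rw [← integral_complex_ofReal, ← integral_const_mul]
        refine integral_congr_ae (Filter.Eventually.of_forall fun y ↦ ?_)
        simp only [Complex.ofReal_mul]
        ring

/-- This identifies the function `g` in `IsSolution` with the convolution at every point: equal
distributions give equality almost everywhere, and continuity does the rest. -/
theorem toDistribution_injective : Function.Injective toDistribution := by
  intro f g h
  have h1 := LinearMap.ker_eq_bot.1
    (Lp.ker_toTemperedDistributionCLM_eq_bot (F := ℂ) (μ := (volume : Measure ℝ)) (p := ⊤)) h
  have h2 : (fun x ↦ (f x : ℂ)) =ᵐ[volume] fun x ↦ (g x : ℂ) :=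
    (MemLp.toLp_eq_toLp_iff _ _).1 h1
  have hf := f.continuous
  have hg := g.continuous
  have h3 := (Continuous.ae_eq_iff_eq volume (by fun_prop) (by fun_prop)).1 h2
  ext x
  exact_mod_cast congrFun h3 x

theorem IsSolution.eq_besselConv {s μ κ : ℝ} (hs0 : 0 < s) (hs1 : s < 1) {φ : ℝ →ᵇ ℝ}
    (h : IsSolution s μ κ φ) (x : ℝ) :
    -μ * φ x + 1 / 2 * φ x ^ 2 + 3 / 2 * besselConv s (fun y ↦ φ y ^ 2) x = κ := by
  obtain ⟨g, hg, h⟩ := h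
  rw [besselOp_toDistribution hs0 hs1] at hg
  rw [← h x, toDistribution_injective hg]
  rfl

/-! ### Continuity estimates for convolutions with the kernel -/

theorem exists_setIntegral_besselKernel_le {s : ℝ} (hs0 : 0 < s) (hs1 : s < 1) :
    ∃ C : ℝ, 0 < C ∧ ∀ t : ℝ, 0 ≤ t → ∫ z in Ioc 0 t, besselKernel s z ≤ C * t ^ s := by
  obtain ⟨C, hC, hK⟩ := exists_besselKernel_le hs0 hs1
  refine ⟨C / s, by positivity, fun t ht ↦ ?_⟩
  have hi : IntervalIntegrable (fun z : ℝ ↦ z ^ (s - 1)) volume 0 t :=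
    intervalIntegral.intervalIntegrable_rpow' (by linarith)
  calc ∫ z in Ioc 0 t, besselKernel s z ≤ ∫ z in Ioc 0 t, C * z ^ (s - 1) :=
        setIntegral_mono_on (integrable_besselKernel hs0 hs1).integrableOn
          (((intervalIntegrable_iff_integrableOn_Ioc_of_le ht).1 hi).const_mul C)
          measurableSet_Ioc fun z hz ↦ hK z hz.1
    _ = C / s * t ^ s := by
        rw [integral_const_mul, ← intervalIntegral.integral_of_le ht,
          integral_rpow (Or.inl (by linarith)), sub_add_cancel, Real.zero_rpow hs0.ne']
        ring

theorem abs_besselKernel_sub_eq {s : ℝ} (hs0 : 0 < s) (hs1 : s < 1) {h z : ℝ} (hh : 0 < h)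
    -- The value `z = h` must be excluded: at the origin the defining integral diverges, so the
    -- kernel takes the default value `0` there.
    (hz : 0 < z) (hzh : z ≠ h) : |besselKernel s (z + h) - besselKernel s (z - h)| =
      besselKernel s (z - h) - besselKernel s (z + h) := by
  rw [abs_sub_comm, abs_of_nonneg]
  have h1 : besselKernel s (z - h) = besselKernel s |z - h| := by
    rcases abs_choice (z - h) with e | e <;> rw [e]
    rw [besselKernel_neg]
  rw [h1, sub_nonneg]
  refine antitoneOn_besselKernel hs0 hs1 (abs_pos.2 (sub_ne_zero.2 hzh))
    (show 0 < z + h by linarith) ?_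
  exact abs_le.2 ⟨by linarith, by linarith⟩

theorem integral_add_right_Ioi (f : ℝ → ℝ) (a h : ℝ) :
    ∫ z in Ioi a, f (z + h) = ∫ z in Ioi (a + h), f z := by
  have := (measurePreserving_add_right volume h).setIntegral_preimage_emb
    (MeasurableEquiv.addRight h).measurableEmbedding f (Ioi (a + h))
  rwa [preimage_add_const_Ioi, add_sub_cancel_right] at this

/-- By monotonicity the difference has one sign on each half-line, so the integral over `z > 0`
telescopes to the mass of `K` on `(-h, h]`. Evenness accounts for the two factors of two. -/
theorem integral_abs_besselKernel_sub {s : ℝ} (hs0 : 0 < s) (hs1 : s < 1) {h : ℝ} (hh : 0 < h) :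
    ∫ z, |besselKernel s (z + h) - besselKernel s (z - h)| =
      4 * ∫ z in Ioc 0 h, besselKernel s z := by
  have hi := integrable_besselKernel hs0 hs1
  have h1 : ∀ z : ℝ, |besselKernel s (z + h) - besselKernel s (z - h)| =
      |besselKernel s (|z| + h) - besselKernel s (|z| - h)| := by
    intro z
    rcases abs_choice z with e | e <;> rw [e]
    rw [abs_sub_comm, ← besselKernel_neg s (z - h), ← besselKernel_neg s (z + h)]
    ring_nf
  rw [integral_congr_ae (Filter.Eventually.of_forall h1),
    integral_comp_abs (f := fun z ↦ |besselKernel s (z + h) - besselKernel s (z - h)|)]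
  have h2 : ∫ z in Ioi (0 : ℝ), |besselKernel s (z + h) - besselKernel s (z - h)| =
      ∫ z in Ioi (0 : ℝ), (besselKernel s (z - h) - besselKernel s (z + h)) := by
    refine integral_congr_ae ?_
    filter_upwards [ae_restrict_mem measurableSet_Ioi,
      ae_restrict_of_ae (Measure.ae_ne volume h)] with z hz hzh
    exact abs_besselKernel_sub_eq hs0 hs1 hh hz hzh
  have h3 : ∫ z in Ioi (0 : ℝ), besselKernel s (z - h) = ∫ z in Ioi (-h), besselKernel s z := by
    simpa only [sub_eq_add_neg, zero_add] using integral_add_right_Ioi (besselKernel s) 0 (-h)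
  have h4 : ∫ z in Ioi (0 : ℝ), besselKernel s (z + h) = ∫ z in Ioi h, besselKernel s z := by
    simpa only [zero_add] using integral_add_right_Ioi (besselKernel s) 0 h
  have h5 : ∫ z in Ioi (-h), besselKernel s z = (∫ z in Ioc (-h) 0, besselKernel s z) +
      ∫ z in Ioi 0, besselKernel s z := by
    rw [← setIntegral_union (Ioc_disjoint_Ioi le_rfl) measurableSet_Ioi hi.integrableOn
      hi.integrableOn, Ioc_union_Ioi_eq_Ioi (by linarith)]
  have h6 : ∫ z in Ioi 0, besselKernel s z = (∫ z in Ioc 0 h, besselKernel s z) +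
      ∫ z in Ioi h, besselKernel s z := by
    rw [← setIntegral_union (Ioc_disjoint_Ioi le_rfl) measurableSet_Ioi hi.integrableOn
      hi.integrableOn, Ioc_union_Ioi_eq_Ioi hh.le]
  have h7 : ∫ z in Ioc (-h) 0, besselKernel s z = ∫ z in Ioc 0 h, besselKernel s z := by
    rw [← intervalIntegral.integral_of_le (by linarith), ← intervalIntegral.integral_of_le hh.le]
    have := intervalIntegral.integral_comp_neg (a := 0) (b := h) (besselKernel s)
    simp only [besselKernel_neg, neg_zero] at this
    exact this.symm
  rw [h2, integral_sub (hi.comp_sub_right h).integrableOn (hi.comp_add_right h).integrableOn,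
    h3, h4, h5, h6, h7]
  ring

theorem exists_integral_abs_besselKernel_sub_le {s : ℝ} (hs0 : 0 < s) (hs1 : s < 1) :
    ∃ C : ℝ, 0 < C ∧ ∀ x y : ℝ,
      ∫ z, |besselKernel s (z + x) - besselKernel s (z + y)| ≤ C * |x - y| ^ s := by
  obtain ⟨C, hC, hK⟩ := exists_setIntegral_besselKernel_le hs0 hs1
  have key : ∀ x y : ℝ, y < x →
      ∫ z, |besselKernel s (z + x) - besselKernel s (z + y)| ≤ 4 * C * |x - y| ^ s := by
    intro x y hxy
    have hh : 0 < (x - y) / 2 := by linarith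
    have h1 := integral_abs_besselKernel_sub hs0 hs1 hh
    -- Translating by the midpoint makes the two shifts symmetric, with half-distance `(x - y) / 2`.
    rw [← integral_add_right_eq_self _ ((x + y) / 2)] at h1
    have e1 : ∀ z : ℝ, z + (x + y) / 2 + (x - y) / 2 = z + x := fun z ↦ by ring
    have e2 : ∀ z : ℝ, z + (x + y) / 2 - (x - y) / 2 = z + y := fun z ↦ by ring
    simp only [e1, e2] at h1
    rw [h1, abs_of_pos (by linarith : 0 < x - y), mul_assoc]
    refine mul_le_mul_of_nonneg_left ((hK _ hh.le).trans ?_) (by norm_num)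
    gcongr
    linarith
  refine ⟨4 * C, by positivity, fun x y ↦ ?_⟩
  rcases lt_trichotomy x y with hxy | rfl | hxy
  · have := key y x hxy
    simp only [abs_sub_comm (besselKernel s (_ + x))]
    rwa [abs_sub_comm x y]
  · simp [Real.zero_rpow hs0.ne']
  · exact key x y hxy

theorem besselConv_eq (s : ℝ) (w : ℝ → ℝ) (x : ℝ) :
    besselConv s w x = ∫ z, besselKernel s (z - x) * w z := by
  rw [besselConv, ← integral_sub_left_eq_self _ volume x]
  simp only [sub_sub_cancel]
  refine integral_congr_ae (Filter.Eventually.of_forall fun z ↦ ?_)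
  simp only
  rw [← besselKernel_neg, neg_sub]

theorem integrable_besselKernel_add_mul {s : ℝ} (hs0 : 0 < s) (hs1 : s < 1) {w : ℝ → ℝ}
    (hw : Continuous w) {M : ℝ} (hM : ∀ x, |w x| ≤ M) (x : ℝ) :
    Integrable fun z ↦ besselKernel s (z + x) * w z :=
  ((integrable_besselKernel hs0 hs1).comp_add_right x).mul_bdd (c := M) hw.aestronglyMeasurable
    (Filter.Eventually.of_forall hM)

theorem integrable_besselKernel_sub_mul {s : ℝ} (hs0 : 0 < s) (hs1 : s < 1) {w : ℝ → ℝ}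
    (hw : Continuous w) {M : ℝ} (hM : ∀ x, |w x| ≤ M) (x : ℝ) :
    Integrable fun z ↦ besselKernel s (z - x) * w z := by
  simpa only [sub_eq_add_neg] using integrable_besselKernel_add_mul hs0 hs1 hw hM (-x)

/-- The convolution of a bounded continuous function is Hölder continuous. -/
theorem exists_abs_besselConv_sub_le {s : ℝ} (hs0 : 0 < s) (hs1 : s < 1) :
    ∃ C : ℝ, 0 < C ∧ ∀ (w : ℝ → ℝ) (M : ℝ), Continuous w → (∀ x, |w x| ≤ M) → ∀ x y : ℝ,
      |besselConv s w x - besselConv s w y| ≤ C * M * |x - y| ^ s := by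
  obtain ⟨C, hC, hK⟩ := exists_integral_abs_besselKernel_sub_le hs0 hs1
  refine ⟨C, hC, fun w M hw hM x y ↦ ?_⟩
  have hM0 : 0 ≤ M := (abs_nonneg _).trans (hM 0)
  have hi := integrable_besselKernel hs0 hs1
  rw [besselConv_eq, besselConv_eq, ← integral_sub (integrable_besselKernel_sub_mul hs0 hs1 hw hM x)
    (integrable_besselKernel_sub_mul hs0 hs1 hw hM y)]
  calc |∫ z, (besselKernel s (z - x) * w z - besselKernel s (z - y) * w z)|
      ≤ ∫ z, |besselKernel s (z - x) - besselKernel s (z - y)| * M := by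
        rw [← Real.norm_eq_abs]
        refine norm_integral_le_of_norm_le
          (((hi.comp_sub_right x).sub (hi.comp_sub_right y)).abs.mul_const M)
          (Filter.Eventually.of_forall fun z ↦ ?_)
        rw [← sub_mul, norm_mul]
        exact mul_le_mul_of_nonneg_left (hM z) (abs_nonneg _)
    _ ≤ C * |x - y| ^ s * M := by
        rw [integral_mul_const]
        refine mul_le_mul_of_nonneg_right ?_ hM0
        have := hK (-x) (-y)
        rw [show |-x - -y| = |x - y| by rw [neg_sub_neg, abs_sub_comm]] at this
        simpa only [sub_eq_add_neg] using this
    _ = _ := by ring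

theorem besselConv_of_even {s : ℝ} (hs0 : 0 < s) (hs1 : s < 1) {w : ℝ → ℝ}
    (hw : Continuous w) {M : ℝ} (hM : ∀ x, |w x| ≤ M) (heven : ∀ x, w (-x) = w x) (x : ℝ) :
    besselConv s w x =
      ∫ z in Ioi 0, (besselKernel s (z + x) + besselKernel s (z - x)) * w z := by
  have h1 := integrable_besselKernel_sub_mul hs0 hs1 hw hM x
  have h2 := integrable_besselKernel_add_mul hs0 hs1 hw hM x
  rw [besselConv_eq, ← intervalIntegral.integral_Iic_add_Ioi (b := 0) h1.integrableOn
    h1.integrableOn]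
  have h3 : ∫ z in Iic (0 : ℝ), besselKernel s (z - x) * w z =
      ∫ z in Ioi (0 : ℝ), besselKernel s (z + x) * w z := by
    have e := integral_comp_neg_Iic 0 fun z ↦ besselKernel s (z + x) * w z
    rw [neg_zero] at e
    rw [← e]
    refine setIntegral_congr_fun measurableSet_Iic fun z _ ↦ ?_
    rw [heven, ← besselKernel_neg s (-z + x)]
    ring_nf
  rw [h3, ← integral_add h2.integrableOn h1.integrableOn]
  refine integral_congr_ae (Filter.Eventually.of_forall fun z ↦ ?_)
  simp only
  ring

theorem besselConv_sub_of_even {s : ℝ} (hs0 : 0 < s) (hs1 : s < 1) {w : ℝ → ℝ}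
    (hw : Continuous w) {M : ℝ} (hM : ∀ x, |w x| ≤ M) (heven : ∀ x, w (-x) = w x) (x y : ℝ) :
    IntegrableOn (fun z ↦ (besselKernel s (z + x) + besselKernel s (z - x) -
        (besselKernel s (z + y) + besselKernel s (z - y))) * w z) (Ioi 0) ∧
    besselConv s w x - besselConv s w y =
      ∫ z in Ioi 0, (besselKernel s (z + x) + besselKernel s (z - x) -
        (besselKernel s (z + y) + besselKernel s (z - y))) * w z := by
  have hi : ∀ t, IntegrableOn (fun z ↦ (besselKernel s (z + t) + besselKernel s (z - t)) * w z)
      (Ioi 0) := fun t ↦ by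
    have h := (integrable_besselKernel_add_mul hs0 hs1 hw hM t).add
      (integrable_besselKernel_sub_mul hs0 hs1 hw hM t)
    refine (h.congr (Filter.Eventually.of_forall fun z ↦ ?_)).integrableOn
    simp only [Pi.add_apply]
    ring
  rw [besselConv_of_even hs0 hs1 hw hM heven, besselConv_of_even hs0 hs1 hw hM heven,
    ← integral_sub (hi x) (hi y)]
  have e : ∀ z, (besselKernel s (z + x) + besselKernel s (z - x) -
      (besselKernel s (z + y) + besselKernel s (z - y))) * w z =
      (besselKernel s (z + x) + besselKernel s (z - x)) * w z -
      (besselKernel s (z + y) + besselKernel s (z - y)) * w z := fun z ↦ sub_mul _ _ _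
  simp only [e]
  exact ⟨(hi x).sub (hi y), trivial⟩

/-- A weighted Hölder estimate for convolutions of even functions that vanish at the origin like
`|z| ^ s`, up to an additive constant. -/
theorem exists_abs_besselConv_sub_le_of_even {s : ℝ} (hs0 : 0 < s) (hs1 : s < 1) :
    ∃ C : ℝ, 0 < C ∧ ∀ (w : ℝ → ℝ) (M N E : ℝ), Continuous w → (∀ x, |w x| ≤ M) →
      (∀ x, w (-x) = w x) → 0 ≤ N → 0 ≤ E → (∀ z, |w z| ≤ N * (|z| ^ s + E)) →
      ∀ x y R : ℝ, |x| ≤ R → |y| ≤ R →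
      |besselConv s w x - besselConv s w y| ≤ C * N * (R ^ s + E) * |x - y| ^ s := by
  obtain ⟨C₁, hC₁, hK₁⟩ := exists_integral_abs_besselKernel_sub_le hs0 hs1
  obtain ⟨C₂, hC₂, hK₂⟩ := exists_abs_besselKernel_diff_le hs0 hs1
  have hs2 : 0 < 2 - 2 * s := by linarith
  refine ⟨4 * C₁ + 2 * C₂ / (2 - 2 * s), by positivity,
    fun w M N E hw hM heven hN hE hwN x y R hx hy ↦ ?_⟩
  have hR : 0 ≤ R := (abs_nonneg x).trans hx
  rcases hR.eq_or_lt with hR0 | hR0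
  · rw [← hR0] at hx hy
    rw [abs_nonpos_iff.1 hx, abs_nonpos_iff.1 hy]
    simp [Real.zero_rpow hs0.ne']
  set F : ℝ → ℝ := fun z ↦ besselKernel s (z + x) + besselKernel s (z - x) -
        (besselKernel s (z + y) + besselKernel s (z - y)) with hF
  obtain ⟨hint, heq⟩ := besselConv_sub_of_even hs0 hs1 hw hM heven x y
  have hi := integrable_besselKernel hs0 hs1
  have iF : Integrable F := ((hi.comp_add_right x).add (hi.comp_sub_right x)).sub
    ((hi.comp_add_right y).add (hi.comp_sub_right y))
  have hd : |x - y| ≤ 2 * R := by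
    have := abs_sub x y
    linarith
  -- At scales up to `2 R` the weight is bounded by a multiple of `R ^ s + E`, and the `L¹` modulus
  -- of continuity of the kernel supplies `|x - y| ^ s`.
  have near : ∫ z in Ioc 0 (2 * R), |F z * w z| ≤ 4 * C₁ * N * (R ^ s + E) * |x - y| ^ s := by
    have hFint : ∫ z, |F z| ≤ 2 * C₁ * |x - y| ^ s := by
      have a1 := hK₁ x y
      have a2 := hK₁ (-x) (-y)
      rw [show |-x - -y| = |x - y| by rw [neg_sub_neg, abs_sub_comm]] at a2
      simp only [← sub_eq_add_neg] at a2
      have j1 := ((hi.comp_add_right x).sub (hi.comp_add_right y)).abs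
      have j2 := ((hi.comp_sub_right x).sub (hi.comp_sub_right y)).abs
      have := integral_mono iF.abs (j1.add j2) (fun z ↦ by
        simp only [hF, Pi.add_apply, Pi.sub_apply]
        refine le_trans (le_of_eq ?_) (abs_add_le _ _)
        congr 1
        ring)
      rw [integral_add' j1 j2] at this
      simp only [Pi.sub_apply] at this
      linarith
    have hwle : ∀ z ∈ Ioc 0 (2 * R), |F z * w z| ≤ |F z| * (2 * N * (R ^ s + E)) := by
      intro z hz
      rw [abs_mul]
      refine mul_le_mul_of_nonneg_left ((hwN z).trans ?_) (abs_nonneg _)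
      have h2 : |z| ^ s ≤ 2 * R ^ s := by
        rw [abs_of_pos hz.1]
        calc z ^ s ≤ (2 * R) ^ s := Real.rpow_le_rpow hz.1.le hz.2 hs0.le
          _ = 2 ^ s * R ^ s := Real.mul_rpow (by norm_num) hR
          _ ≤ 2 ^ (1 : ℝ) * R ^ s := by
            gcongr
            norm_num
          _ = _ := by rw [Real.rpow_one]
      nlinarith [mul_nonneg hN hE]
    calc ∫ z in Ioc 0 (2 * R), |F z * w z|
        ≤ ∫ z in Ioc 0 (2 * R), |F z| * (2 * N * (R ^ s + E)) :=
          setIntegral_mono_on (hint.mono_set Ioc_subset_Ioi_self).abs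
            (iF.abs.mul_const _).integrableOn measurableSet_Ioc hwle
      _ ≤ (∫ z, |F z|) * (2 * N * (R ^ s + E)) := by
          rw [integral_mul_const]
          refine mul_le_mul_of_nonneg_right ?_ (by positivity)
          exact setIntegral_le_integral iF.abs (Filter.Eventually.of_forall fun z ↦ abs_nonneg _)
      _ ≤ (2 * C₁ * |x - y| ^ s) * (2 * N * (R ^ s + E)) := by gcongr
      _ = _ := by ring
  -- Beyond `2 R` the decay `z ^ (s - 3)` beats the growth `z ^ s`, since `2 s - 3 < -1`. The
  -- resulting factor `|x - y| R ^ (s - 1)` is at most `2 |x - y| ^ s` because `|x - y| ≤ 2 R`.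
  have far : ∫ z in Ioi (2 * R), |F z * w z| ≤
      2 * C₂ / (2 - 2 * s) * N * (R ^ s + E) * |x - y| ^ s := by
    have j1 := integrableOn_Ioi_rpow_of_lt (a := 2 * s - 3) (c := 2 * R) (by linarith)
      (by positivity)
    have j2 := integrableOn_Ioi_rpow_of_lt (a := s - 3) (c := 2 * R) (by linarith) (by positivity)
    have hle : ∀ z ∈ Ioi (2 * R), |F z * w z| ≤
        C₂ * |x - y| * R * N * (z ^ (2 * s - 3) + E * z ^ (s - 3)) := by
      intro z hz
      have hz0 : 0 < z := lt_trans (by positivity) hz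
      rw [abs_mul]
      have h1 := hK₂ x y R z hx hy hz0 (le_of_lt hz)
      have h2 := hwN z
      rw [abs_of_pos hz0] at h2
      calc |F z| * |w z| ≤ (C₂ * |x - y| * R * z ^ (s - 3)) * (N * (z ^ s + E)) := by gcongr
        _ = _ := by
          rw [show 2 * s - 3 = (s - 3) + s by ring, Real.rpow_add hz0]
          ring
    have hp1 : -(2 * R) ^ (2 * s - 3 + 1) / (2 * s - 3 + 1) ≤ R ^ (s - 1) * R ^ (s - 1) / (2 - 2 * s) := by
      rw [← neg_div_neg_eq, neg_neg, show -(2 * s - 3 + 1) = 2 - 2 * s by ring,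
        ← Real.rpow_add hR0, show s - 1 + (s - 1) = 2 * s - 3 + 1 by ring]
      gcongr ?_ / _
      exact Real.rpow_le_rpow_of_nonpos hR0 (by linarith) (by linarith)
    have hp2 : -(2 * R) ^ (s - 3 + 1) / (s - 3 + 1) ≤ R ^ (s - 1) * R⁻¹ / (2 - 2 * s) := by
      rw [← neg_div_neg_eq, neg_neg, show -(s - 3 + 1) = 2 - s by ring,
        ← Real.rpow_neg_one R, ← Real.rpow_add hR0, show s - 1 + -1 = s - 3 + 1 by ring]
      have := Real.rpow_le_rpow_of_nonpos hR0 (by linarith : R ≤ 2 * R)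
        (by linarith : s - 3 + 1 ≤ 0)
      gcongr
      linarith
    have hdR : |x - y| * R ^ (s - 1) ≤ 2 * |x - y| ^ s := by
      rcases (abs_nonneg (x - y)).eq_or_lt with h0 | h0
      · rw [← h0]
        simp [Real.zero_rpow hs0.ne']
      · have e1 : |x - y| = |x - y| ^ s * |x - y| ^ (1 - s) := by
          rw [← Real.rpow_add h0, show s + (1 - s) = 1 by ring, Real.rpow_one]
        have e2 : |x - y| ^ (1 - s) ≤ 2 * R ^ (1 - s) := by
          calc |x - y| ^ (1 - s) ≤ (2 * R) ^ (1 - s) :=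
                Real.rpow_le_rpow h0.le hd (by linarith)
            _ = 2 ^ (1 - s) * R ^ (1 - s) := Real.mul_rpow (by norm_num) hR
            _ ≤ 2 ^ (1 : ℝ) * R ^ (1 - s) := by
              gcongr
              · norm_num
              · linarith
            _ = _ := by rw [Real.rpow_one]
        have e3 : R ^ (1 - s) * R ^ (s - 1) = 1 := by
          rw [← Real.rpow_add hR0]
          simp
        calc |x - y| * R ^ (s - 1) = |x - y| ^ s * |x - y| ^ (1 - s) * R ^ (s - 1) := by
              rw [← e1]
          _ ≤ |x - y| ^ s * (2 * R ^ (1 - s)) * R ^ (s - 1) := by gcongr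
          _ = 2 * |x - y| ^ s * (R ^ (1 - s) * R ^ (s - 1)) := by ring
          _ = _ := by rw [e3, mul_one]
    have eR : R * R ^ (s - 1) = R ^ s := by
      nth_rewrite 1 [← Real.rpow_one R]
      rw [← Real.rpow_add hR0]
      ring_nf
    calc ∫ z in Ioi (2 * R), |F z * w z|
        ≤ ∫ z in Ioi (2 * R), C₂ * |x - y| * R * N * (z ^ (2 * s - 3) + E * z ^ (s - 3)) :=
          setIntegral_mono_on (hint.mono_set (Ioi_subset_Ioi (by positivity))).abs
            ((j1.add (j2.const_mul E)).const_mul _) measurableSet_Ioi hle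
      _ = C₂ * |x - y| * R * N * (-(2 * R) ^ (2 * s - 3 + 1) / (2 * s - 3 + 1) +
            E * (-(2 * R) ^ (s - 3 + 1) / (s - 3 + 1))) := by
          rw [integral_const_mul, integral_add j1 (j2.const_mul E), integral_const_mul,
            integral_Ioi_rpow_of_lt (by linarith) (by positivity),
            integral_Ioi_rpow_of_lt (by linarith) (by positivity)]
      _ ≤ C₂ * |x - y| * R * N * (R ^ (s - 1) * R ^ (s - 1) / (2 - 2 * s) +
            E * (R ^ (s - 1) * R⁻¹ / (2 - 2 * s))) := by gcongr
      _ = C₂ / (2 - 2 * s) * N * ((R * R ^ (s - 1)) + E * (R * R⁻¹)) * (|x - y| * R ^ (s - 1)) := by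
          ring
      _ ≤ C₂ / (2 - 2 * s) * N * (R ^ s + E) * (2 * |x - y| ^ s) := by
          rw [eR, mul_inv_cancel₀ hR0.ne', mul_one]
          gcongr
      _ = _ := by ring
  rw [heq]
  calc |∫ z in Ioi 0, F z * w z| ≤ ∫ z in Ioi 0, |F z * w z| := abs_integral_le_integral_abs
    _ = (∫ z in Ioc 0 (2 * R), |F z * w z|) + ∫ z in Ioi (2 * R), |F z * w z| := by
        rw [← setIntegral_union (Ioc_disjoint_Ioi le_rfl) measurableSet_Ioi
          (hint.mono_set Ioc_subset_Ioi_self).abs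
          (hint.mono_set (Ioi_subset_Ioi (by positivity))).abs,
          Ioc_union_Ioi_eq_Ioi (by positivity)]
    _ ≤ _ := by
        refine (add_le_add near far).trans (le_of_eq ?_)
        ring

/-! ### Lower bounds at a minimum -/

theorem besselConv_sub_zero_of_even {s : ℝ} (hs0 : 0 < s) (hs1 : s < 1) {w : ℝ → ℝ}
    (hw : Continuous w) {M : ℝ} (hM : ∀ x, |w x| ≤ M) (heven : ∀ x, w (-x) = w x) (x : ℝ) :
    IntegrableOn (fun z ↦ kernelDiff s x z * w z) (Ioi 0) ∧
    besselConv s w x - besselConv s w 0 = ∫ z in Ioi 0, kernelDiff s x z * w z := by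
  have h := besselConv_sub_of_even hs0 hs1 hw hM heven x 0
  simpa only [add_zero, sub_zero, ← two_mul, kernelDiff] using h

theorem besselConv_const (s a x : ℝ) :
    besselConv s (fun _ ↦ a) x = (∫ y, besselKernel s y) * a := integral_mul_const _ _

/-- Convolving the constant `1` gives a constant. The zero mean allows any constant to be subtracted
from `w` under the integral. -/
theorem integral_kernelDiff {s : ℝ} (hs0 : 0 < s) (hs1 : s < 1) (x : ℝ) :
    IntegrableOn (kernelDiff s x) (Ioi 0) ∧ ∫ z in Ioi 0, kernelDiff s x z = 0 := by
  have h := besselConv_sub_zero_of_even hs0 hs1 (w := fun _ ↦ 1) continuous_const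
    (M := 1) (by simp) (by simp) x
  simp only [mul_one, besselConv_const, sub_self] at h
  exact ⟨h.1, h.2.symm⟩

/-- A nonnegative even function vanishing near the origin whose convolution does not increase away
from the origin vanishes identically. -/
theorem eq_zero_of_besselConv_le_of_eq_zero {s : ℝ} (hs0 : 0 < s) (hs1 : s < 1) {w : ℝ → ℝ}
    (hw : Continuous w) {M : ℝ} (hM : ∀ x, |w x| ≤ M) (heven : ∀ x, w (-x) = w x)
    (hnonneg : ∀ x, 0 ≤ w x) {x : ℝ} (hx : 0 < x) (hzero : ∀ z ∈ Icc 0 x, w z = 0)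
    (hle : besselConv s w x ≤ besselConv s w 0) (z : ℝ) : w z = 0 := by
  by_contra hz
  obtain ⟨hint, heq⟩ := besselConv_sub_zero_of_even hs0 hs1 hw hM heven x
  have hz' : w |z| ≠ 0 := by
    rcases abs_choice z with e | e <;> rw [e]
    · exact hz
    · rwa [heven]
  have hxz : x < |z| := by
    by_contra h
    exact hz' (hzero _ ⟨abs_nonneg z, not_lt.1 h⟩)
  have hpos : 0 < ∫ t in Ioi 0, kernelDiff s x t * w t := by
    rw [setIntegral_pos_iff_support_of_nonneg_ae _ hint]
    · have hopen : IsOpen (Ioi x ∩ {t | w t ≠ 0}) :=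
        isOpen_Ioi.inter (isOpen_ne_fun hw continuous_const)
      refine (hopen.measure_pos volume ⟨|z|, hxz, hz'⟩).trans_le (measure_mono ?_)
      rintro t ⟨ht, hwt⟩
      refine ⟨mul_ne_zero (kernelDiff_pos hs0 hs1 hx.ne' ?_).ne' hwt, hx.trans ht⟩
      rwa [abs_of_pos hx]
    · filter_upwards [ae_restrict_mem measurableSet_Ioi] with t ht
      rcases le_or_gt t x with htx | htx
      · simp [hzero t ⟨le_of_lt ht, htx⟩]
      · have h := kernelDiff_pos hs0 hs1 hx.ne' (h := x) (z := t) (by rwa [abs_of_pos hx])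
        exact mul_nonneg h.le (hnonneg t)
  rw [← heq] at hpos
  linarith

theorem exists_sign_change {f : ℝ → ℝ} {x : ℝ} (hx : 0 < x) (hf : MonotoneOn f (Ioo 0 x)) :
    ∃ y ∈ Icc 0 x, (∀ z ∈ Ioo 0 x, z < y → f z ≤ 0) ∧ ∀ z ∈ Ioo 0 x, y < z → 0 ≤ f z := by
  -- Inserting `0` keeps the set nonempty when `f` is positive throughout.
  set S := insert 0 {z ∈ Ioo 0 x | f z ≤ 0} with hS
  have hbdd : BddAbove S := ⟨x, by
    rintro z (rfl | hz)
    · exact hx.le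
    · exact hz.1.2.le⟩
  have h0 : (0 : ℝ) ∈ S := mem_insert _ _
  refine ⟨sSup S, ⟨le_csSup hbdd h0, csSup_le ⟨0, h0⟩ ?_⟩, fun z hz hzS ↦ ?_, fun z hz hzS ↦ ?_⟩
  · rintro z (rfl | hz)
    · exact hx.le
    · exact hz.1.2.le
  · obtain ⟨t, ht, hzt⟩ := exists_lt_of_lt_csSup ⟨0, h0⟩ hzS
    rcases ht with rfl | ht
    · exact absurd hz.1 (not_lt.2 hzt.le)
    · exact (hf hz ht.1 hzt.le).trans ht.2
  · by_contra h
    exact absurd (le_csSup hbdd (mem_insert_of_mem _ ⟨hz, (not_le.1 h).le⟩)) (not_le.2 hzS)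

/-- A lower bound for the increase of the convolution of a nonnegative even function that is
increasing on an interval `[0, b]`. -/
theorem exists_le_besselConv_sub {s : ℝ} (hs0 : 0 < s) (hs1 : s < 1) :
    ∃ c C : ℝ, 0 < c ∧ 0 < C ∧ ∀ (w : ℝ → ℝ) (M b : ℝ), Continuous w → (∀ x, |w x| ≤ M) →
      (∀ x, w (-x) = w x) → (∀ x, 0 ≤ w x) → b ≤ 1 → MonotoneOn w (Icc 0 b) →
      ∀ x y : ℝ, 0 < x → x ≤ y → 2 * y ≤ b →
      x ^ 2 * (c * y ^ (s - 2) * (w y - w x) - C * b ^ (s - 2) * w x) ≤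
        besselConv s w x - besselConv s w 0 := by
  obtain ⟨c, hc, hKc⟩ := exists_le_kernelDiff hs0 hs1
  obtain ⟨C, hC, hKC⟩ := exists_abs_besselKernel_diff_le hs0 hs1
  have hs2 : 0 < 2 - s := by linarith
  refine ⟨c * 2 ^ (s - 3), C / (2 - s), by positivity, by positivity,
    fun w M b hw hM heven hnonneg hb1 hmono x y hx hxy hyb ↦ ?_⟩
  have hy : 0 < y := hx.trans_le hxy
  have hb : 0 < b := by linarith
  obtain ⟨hint, heq⟩ := besselConv_sub_zero_of_even hs0 hs1 hw hM heven x
  obtain ⟨hDint, hD⟩ := integral_kernelDiff hs0 hs1 x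
  obtain ⟨t, ht, hneg, hpos⟩ := exists_sign_change hx (kernelDiff_monotone hs0 hs1 x)
  have hDpos : ∀ z, x < z → 0 < kernelDiff s x z := fun z hz ↦
    kernelDiff_pos hs0 hs1 hx.ne' (by rwa [abs_of_pos hx])
  have htb : t ∈ Icc 0 b := ⟨ht.1, by linarith [ht.2]⟩
  have hxb : x ∈ Icc 0 b := ⟨hx.le, by linarith⟩
  have hyb' : y ∈ Icc 0 b := ⟨hy.le, by linarith⟩
  have htx : w t ≤ w x := hmono htb hxb ht.2
  have hwxy : w x ≤ w y := hmono hxb hyb' hxy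
  have hDwt : IntegrableOn (fun z ↦ kernelDiff s x z * w z - kernelDiff s x z * w t) (Ioi 0) :=
    hint.sub (hDint.mul_const (w t))
  -- Subtracting the value of `w` at the sign change `t` makes the integrand nonnegative almost
  -- everywhere on `(0, b]`, as both factors change sign at `t`.
  have e1 : ∫ z in Ioi 0, kernelDiff s x z * w z =
      ∫ z in Ioi 0, (kernelDiff s x z * w z - kernelDiff s x z * w t) := by
    rw [integral_sub hint (hDint.mul_const (w t)), integral_mul_const, hD]
    ring
  set A := c * x ^ 2 * (2 * y) ^ (s - 3) * (w y - w x) with hA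
  have hA0 : 0 ≤ A := by
    have : 0 ≤ w y - w x := by linarith
    positivity
  -- `G₁` is the gain retained on `(y, 2y]`. `G₂` bounds the loss beyond `b`, where only `w ≥ 0` is
  -- known and `w z - w t` is at least `-w x`.
  set G₁ : ℝ → ℝ := (Ioc y (2 * y)).indicator fun _ ↦ A
  set G₂ : ℝ → ℝ := (Ioi b).indicator fun z ↦ C * x ^ 2 * w x * z ^ (s - 3)
  have jb := integrableOn_Ioi_rpow_of_lt (a := s - 3) (c := b) (by linarith) hb
  have iG₁ : IntegrableOn G₁ (Ioi 0) :=
    ((integrable_indicator_iff measurableSet_Ioc).2 (integrableOn_const (by simp))).integrableOn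
  have iG₂ : IntegrableOn G₂ (Ioi 0) :=
    ((integrable_indicator_iff measurableSet_Ioi).2 (jb.const_mul _)).integrableOn
  have hG₁ : ∫ z in Ioi 0, G₁ z = y * A := by
    rw [setIntegral_indicator measurableSet_Ioc, inter_eq_right.2 (Ioc_subset_Ioi_self.trans (Ioi_subset_Ioi hy.le)),
      setIntegral_const, measureReal_def, Real.volume_Ioc, ENNReal.toReal_ofReal (by linarith),
      smul_eq_mul]
    ring
  have hG₂ : ∫ z in Ioi 0, G₂ z = C * x ^ 2 * w x * (b ^ (s - 2) / (2 - s)) := by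
    rw [setIntegral_indicator measurableSet_Ioi, inter_eq_right.2 (Ioi_subset_Ioi hb.le),
      integral_const_mul, integral_Ioi_rpow_of_lt (by linarith) hb, ← neg_div_neg_eq, neg_neg,
      show s - 3 + 1 = s - 2 by ring, neg_sub]
  have hle : ∀ᵐ z ∂(volume.restrict (Ioi (0 : ℝ))), G₁ z - G₂ z ≤
      kernelDiff s x z * w z - kernelDiff s x z * w t := by
    filter_upwards [ae_restrict_mem measurableSet_Ioi,
      ae_restrict_of_ae (Measure.ae_ne volume x)] with z hz hzx
    have hz : 0 < z := hz
    rw [← mul_sub]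
    rcases lt_or_gt_of_ne hzx with hzx | hzx
    · have n1 : z ∉ Ioc y (2 * y) := fun h ↦ by linarith [h.1]
      have n2 : z ∉ Ioi b := fun h ↦ by
        have h : b < z := h
        linarith
      simp only [G₁, G₂, indicator_of_notMem n1, indicator_of_notMem n2, sub_self]
      have hzb : z ∈ Icc 0 b := ⟨hz.le, by linarith⟩
      rcases lt_trichotomy z t with h | h | h
      · exact mul_nonneg_of_nonpos_of_nonpos (hneg z ⟨hz, hzx⟩ h)
          (sub_nonpos.2 (hmono hzb htb h.le))
      · rw [h]; simp
      · exact mul_nonneg (hpos z ⟨hz, hzx⟩ h) (sub_nonneg.2 (hmono htb hzb h.le))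
    · have hDz := hDpos z hzx
      by_cases n2 : z ∈ Ioi b
      · have hbz : b < z := n2
        have n1 : z ∉ Ioc y (2 * y) := fun h ↦ by linarith [h.2]
        simp only [G₁, G₂, indicator_of_notMem n1, indicator_of_mem n2]
        have h1 := hKC x 0 x z (abs_of_pos hx).le (by simpa using hx.le) hz (by linarith)
        simp only [add_zero, sub_zero, ← two_mul] at h1
        have h2 : kernelDiff s x z ≤ C * x ^ 2 * z ^ (s - 3) := by
          refine (le_abs_self _).trans (h1.trans (le_of_eq ?_))
          rw [abs_of_pos hx]
          ring
        have h3 := hnonneg z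
        have h4 := hnonneg x
        have h5 : kernelDiff s x z * (w t - w z) ≤ C * x ^ 2 * z ^ (s - 3) * w x := by
          calc _ ≤ kernelDiff s x z * w x := by gcongr; linarith
            _ ≤ _ := by gcongr
        linarith
      · have hzb : z ≤ b := not_lt.1 n2
        have hzb' : z ∈ Icc 0 b := ⟨hz.le, hzb⟩
        simp only [G₂, indicator_of_notMem n2, sub_zero]
        by_cases n1 : z ∈ Ioc y (2 * y)
        · simp only [G₁, indicator_of_mem n1, hA]
          have h1 := hKc x z (by rwa [abs_of_pos hx]) (hzb.trans hb1)
          have h2 : (2 * y) ^ (s - 3) ≤ z ^ (s - 3) :=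
            Real.rpow_le_rpow_of_nonpos hz n1.2 (by linarith)
          have h3 : w y ≤ w z := hmono hyb' hzb' n1.1.le
          have h4 : 0 ≤ w y - w x := by linarith
          calc c * x ^ 2 * (2 * y) ^ (s - 3) * (w y - w x)
              ≤ c * x ^ 2 * z ^ (s - 3) * (w y - w x) := by gcongr
            _ ≤ kernelDiff s x z * (w y - w x) := by gcongr
            _ ≤ kernelDiff s x z * (w z - w t) := by gcongr
        · simp only [G₁, indicator_of_notMem n1]
          exact mul_nonneg hDz.le (sub_nonneg.2 (hmono htb hzb' (ht.2.trans hzx.le)))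
  have hfin := integral_mono_ae (iG₁.sub iG₂) hDwt hle
  simp only [Pi.sub_apply] at hfin
  rw [integral_sub iG₁ iG₂, hG₁, hG₂] at hfin
  rw [heq, e1]
  refine le_trans (le_of_eq ?_) hfin
  rw [hA, Real.mul_rpow (by norm_num) hy.le, show s - 2 = s - 3 + 1 by ring, Real.rpow_add hy,
    Real.rpow_one]
  ring

/-- A nonnegative even function with zero minimum at the origin, increasing near the origin, whose
convolution is maximal at the origin vanishes identically. -/
theorem eq_zero_of_besselConv_le {s : ℝ} (hs0 : 0 < s) (hs1 : s < 1) {w : ℝ → ℝ}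
    (hw : Continuous w) {M : ℝ} (hM : ∀ x, |w x| ≤ M) (heven : ∀ x, w (-x) = w x)
    (hnonneg : ∀ x, 0 ≤ w x) (h0 : w 0 = 0) {b : ℝ} (hb : 0 < b) (hmono : MonotoneOn w (Icc 0 b))
    (hle : ∀ x, besselConv s w x ≤ besselConv s w 0) (z : ℝ) : w z = 0 := by
  obtain ⟨c, C, hc, hC, hL⟩ := exists_le_besselConv_sub hs0 hs1
  set b' := min b 1 with hb'
  have hb'0 : 0 < b' := lt_min hb one_pos
  have hmono' : MonotoneOn w (Icc 0 b') := hmono.mono (Icc_subset_Icc_right (min_le_left _ _))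
  set y := b' / 2 with hy
  have hy0 : 0 < y := by positivity
  -- With `y` fixed, divide the lower bound by `x ^ 2` and let `x` tend to `0`; the terms with `w x`
  -- vanish in the limit.
  have hyle : c * y ^ (s - 2) * w y ≤ 0 := by
    have hcont : Continuous fun x ↦ C * b' ^ (s - 2) * w x - c * y ^ (s - 2) * (w y - w x) := by
      fun_prop
    have hlim := (hcont.tendsto 0).mono_left (nhdsWithin_le_nhds (s := Ioi (0 : ℝ)))
    have hev : ∀ᶠ x in nhdsWithin (0 : ℝ) (Ioi 0),
        0 ≤ C * b' ^ (s - 2) * w x - c * y ^ (s - 2) * (w y - w x) := by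
      filter_upwards [Ioc_mem_nhdsGT hy0] with x hx
      have h1 := hL w M b' hw hM heven hnonneg (min_le_right _ _) hmono' x y hx.1 hx.2
        (by rw [hy]; linarith)
      have h2 : x ^ 2 * (c * y ^ (s - 2) * (w y - w x) - C * b' ^ (s - 2) * w x) ≤ 0 := by
        linarith [hle x]
      have h3 : 0 < x ^ 2 := pow_pos hx.1 2
      have := nonpos_of_mul_nonpos_right h2 h3
      linarith
    have := ge_of_tendsto hlim hev
    rw [h0] at this
    linarith
  have hwy : w y = 0 := by
    have h1 : w y ≤ 0 := nonpos_of_mul_nonpos_right hyle (by positivity)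
    exact le_antisymm h1 (hnonneg y)
  refine eq_zero_of_besselConv_le_of_eq_zero hs0 hs1 hw hM heven hnonneg hy0 (fun t ht ↦ ?_)
    (hle y) z
  have hyb : y ≤ b' := by rw [hy]; linarith
  have := hmono' ⟨ht.1, ht.2.trans hyb⟩ ⟨hy0.le, hyb⟩ ht.2
  exact le_antisymm (this.trans hwy.le) (hnonneg t)

/-! ### Profiles with a crest at the origin -/

theorem sq_sub_sq_le_mul (a b : ℝ) : a ^ 2 - b ^ 2 ≤ 2 * a * (a - b) := by
  nlinarith [sq_nonneg (a - b)]

/-- An even continuous function `φ` with values in `[-μ, μ]` and a crest of height `μ` at the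
origin, decreasing on `[0, b₀]`, that solves the equation in the form
`(μ - φ x) ^ 2 = 3 (K ∗ w (x) - K ∗ w (0))` with `w = μ ^ 2 - φ ^ 2`. -/
structure CrestProfile (s μ b₀ : ℝ) (φ : ℝ → ℝ) : Prop where
  s_pos : 0 < s
  s_lt_one : s < 1
  height_pos : 0 < μ
  length_pos : 0 < b₀
  continuous : Continuous φ
  even : ∀ x, φ (-x) = φ x
  le : ∀ x, φ x ≤ μ
  neg_le : ∀ x, -μ ≤ φ x
  crest : φ 0 = μ
  antitone : AntitoneOn φ (Icc 0 b₀)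
  nonconst : ∃ x, φ x ≠ μ
  eqn : ∀ x, (μ - φ x) ^ 2 = 3 * (besselConv s (fun z ↦ μ ^ 2 - φ z ^ 2) x -
    besselConv s (fun z ↦ μ ^ 2 - φ z ^ 2) 0)

namespace CrestProfile

variable {s μ b₀ : ℝ} {φ : ℝ → ℝ}

theorem continuous_sq (h : CrestProfile s μ b₀ φ) : Continuous fun z ↦ μ ^ 2 - φ z ^ 2 := by
  have := h.continuous
  fun_prop

theorem sq_nonneg (h : CrestProfile s μ b₀ φ) (z : ℝ) : 0 ≤ μ ^ 2 - φ z ^ 2 := by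
  nlinarith [h.le z, h.neg_le z]

theorem abs_sq_le (h : CrestProfile s μ b₀ φ) (z : ℝ) : |μ ^ 2 - φ z ^ 2| ≤ μ ^ 2 := by
  rw [abs_of_nonneg (h.sq_nonneg z)]
  nlinarith [_root_.sq_nonneg (φ z)]

theorem sq_even (h : CrestProfile s μ b₀ φ) (z : ℝ) :
    μ ^ 2 - φ (-z) ^ 2 = μ ^ 2 - φ z ^ 2 := by
  rw [h.even]

theorem eqn_sub (h : CrestProfile s μ b₀ φ) (x y : ℝ) : (μ - φ x) ^ 2 - (μ - φ y) ^ 2 =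
    3 * (besselConv s (fun z ↦ μ ^ 2 - φ z ^ 2) x -
      besselConv s (fun z ↦ μ ^ 2 - φ z ^ 2) y) := by
  rw [h.eqn x, h.eqn y]
  ring

/-- The upper bound at the crest. -/
theorem exists_le_rpow (h : CrestProfile s μ b₀ φ) :
    ∃ C : ℝ, 0 < C ∧ ∀ x, μ - φ x ≤ C * |x| ^ s := by
  have hs0 := h.s_pos
  have hμ := h.height_pos
  obtain ⟨C, hC, hH⟩ := exists_abs_besselConv_sub_le_of_even hs0 h.s_lt_one
  refine ⟨6 * μ * C, by positivity, fun x ↦ ?_⟩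
  -- The shift `E` makes the supremum `S` finite beforehand, so that `S ^ 2 ≤ 6 μ C S` can be
  -- divided by `S`. The constant does not depend on `E`, which is finally sent to `0`.
  have key : ∀ E : ℝ, 0 < E → ∀ x, μ - φ x ≤ 6 * μ * C * (|x| ^ s + E) := by
    intro E hE
    have hpos : ∀ z : ℝ, 0 < |z| ^ s + E := fun z ↦ by positivity
    set S := ⨆ z, (μ - φ z) / (|z| ^ s + E) with hS
    have hbdd : BddAbove (range fun z ↦ (μ - φ z) / (|z| ^ s + E)) := by
      refine ⟨2 * μ / E, ?_⟩
      rintro _ ⟨z, rfl⟩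
      have h1 : 0 ≤ |z| ^ s := by positivity
      have := h.le z
      have := h.neg_le z
      exact div_le_div₀ (by positivity) (by linarith) hE (by linarith)
    have hle : ∀ z, μ - φ z ≤ S * (|z| ^ s + E) := fun z ↦
      (div_le_iff₀ (hpos z)).1 (le_ciSup hbdd z)
    have hS0 : 0 ≤ S :=
      le_trans (div_nonneg (by linarith [h.le 0]) (hpos 0).le) (le_ciSup hbdd 0)
    have hw : ∀ z, |μ ^ 2 - φ z ^ 2| ≤ 2 * μ * S * (|z| ^ s + E) := fun z ↦ by
      rw [abs_of_nonneg (h.sq_nonneg z)]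
      calc _ ≤ 2 * μ * (μ - φ z) := sq_sub_sq_le_mul μ (φ z)
        _ ≤ 2 * μ * (S * (|z| ^ s + E)) := by gcongr; exact hle z
        _ = _ := by ring
    have hsq : ∀ z, ((μ - φ z) / (|z| ^ s + E)) ^ 2 ≤ 6 * μ * C * S := by
      intro z
      rw [div_pow, div_le_iff₀ (pow_pos (hpos z) 2), h.eqn z]
      have h1 := hH _ _ _ E h.continuous_sq h.abs_sq_le h.sq_even (by positivity) hE.le hw z 0 |z|
        le_rfl (by simp)
      rw [sub_zero] at h1
      have h2 := (le_abs_self _).trans h1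
      have h3 : C * (2 * μ * S) * (|z| ^ s + E) * |z| ^ s ≤
          C * (2 * μ * S) * (|z| ^ s + E) * (|z| ^ s + E) := by
        have := (hpos z).le
        gcongr
        linarith
      calc _ ≤ 3 * (C * (2 * μ * S) * (|z| ^ s + E) * (|z| ^ s + E)) := by linarith
        _ = _ := by ring
    have hS1 : S ≤ √(6 * μ * C * S) := ciSup_le fun z ↦ Real.le_sqrt_of_sq_le (hsq z)
    have hS2 : S ≤ 6 * μ * C := by
      have h1 : S ^ 2 ≤ 6 * μ * C * S := by
        have := pow_le_pow_left₀ hS0 hS1 2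
        rwa [Real.sq_sqrt (by positivity)] at this
      rcases hS0.eq_or_lt with h0 | h0
      · rw [← h0]; positivity
      · nlinarith
    intro z
    exact (hle z).trans (mul_le_mul_of_nonneg_right hS2 (hpos z).le)
  refine le_of_forall_pos_le_add fun ε hε ↦ ?_
  have := key (ε / (6 * μ * C)) (by positivity) x
  rwa [mul_add, mul_div_cancel₀ _ (by positivity)] at this

/-- The height `μ` is attained only at the origin, within `[-b₀, b₀]`. -/
theorem lt_of_mem (h : CrestProfile s μ b₀ φ) {x : ℝ} (hx : 0 < x) (hxb : x ≤ b₀) : φ x < μ := by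
  have hμ := h.height_pos
  refine lt_of_le_of_ne (h.le x) fun hxμ ↦ ?_
  have hz : ∀ z ∈ Icc 0 x, φ z = μ := fun z hz ↦ le_antisymm (h.le z)
    (hxμ.symm.le.trans (h.antitone ⟨hz.1, hz.2.trans hxb⟩ ⟨hx.le, hxb⟩ hz.2))
  have hzero := eq_zero_of_besselConv_le_of_eq_zero h.s_pos h.s_lt_one h.continuous_sq h.abs_sq_le
    h.sq_even h.sq_nonneg hx (fun z hz' ↦ by rw [hz z hz', sub_self]) (by
      have := h.eqn x
      rw [hxμ, sub_self] at this
      linarith)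
  obtain ⟨y, hy⟩ := h.nonconst
  have hyμ : φ y = -μ := by
    have h1 : (φ y - μ) * (φ y + μ) = 0 := by linarith [hzero y]
    rcases mul_eq_zero.1 h1 with h1 | h1
    · exact absurd (by linarith) hy
    · linarith
  -- If `φ ^ 2 = μ ^ 2` everywhere and `φ` takes both values `±μ`, then by continuity it has a zero,
  -- where the identity fails.
  obtain ⟨t, ht⟩ := mem_range_of_exists_le_of_exists_ge h.continuous (c := 0)
    ⟨y, by rw [hyμ]; linarith⟩ ⟨0, by rw [h.crest]; exact hμ.le⟩
  have := hzero t
  rw [ht] at this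
  nlinarith

/-- Smallness propagates outwards: with `u = μ - φ`, the bound `u ≤ ε x ^ s` at `x` implies the same
bound at `Λ x`. From a point violating the claim it would reach a scale in `[r / Λ, r]`, where the
choice of `ε` forbids it. -/
theorem exists_rpow_le_of_pos (h : CrestProfile s μ b₀ φ) :
    ∃ c δ : ℝ, 0 < c ∧ 0 < δ ∧ ∀ x, 0 < x → x ≤ δ → c * x ^ s ≤ μ - φ x := by
  have hs0 := h.s_pos
  have hs1 := h.s_lt_one
  have hμ := h.height_pos
  obtain ⟨c, C, hc, hC, hL⟩ := exists_le_besselConv_sub hs0 hs1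
  -- Where `φ ≥ 0`, the function `μ ^ 2 - φ ^ 2` increases as `φ` decreases, and it dominates `μ (μ
  -- - φ)`.
  obtain ⟨b, hb, hbb₀, hb1, hφb⟩ : ∃ b, 0 < b ∧ b ≤ b₀ ∧ b ≤ 1 ∧ 0 ≤ φ b := by
    have h1 : ∀ᶠ b in nhdsWithin (0 : ℝ) (Ioi 0), 0 < φ b :=
      nhdsWithin_le_nhds (h.continuous.continuousAt.eventually
        (lt_mem_nhds (by rw [h.crest]; exact hμ)))
    obtain ⟨b, hb1, hb2⟩ := (h1.and (Ioc_mem_nhdsGT (lt_min h.length_pos one_pos))).exists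
    exact ⟨b, hb2.1, hb2.2.trans (min_le_left _ _), hb2.2.trans (min_le_right _ _), hb1.le⟩
  have hanti : AntitoneOn φ (Icc 0 b) := h.antitone.mono (Icc_subset_Icc_right hbb₀)
  have hnn : ∀ z ∈ Icc 0 b, 0 ≤ φ z := fun z hz ↦ hφb.trans (hanti hz ⟨hb.le, le_rfl⟩ hz.2)
  have hmono : MonotoneOn (fun z ↦ μ ^ 2 - φ z ^ 2) (Icc 0 b) := fun x hx y hy hxy ↦ by
    have h1 := hanti hx hy hxy
    have h2 := pow_le_pow_left₀ (hnn y hy) h1 2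
    simp only
    linarith
  have hwlow : ∀ z ∈ Icc 0 b, μ * (μ - φ z) ≤ μ ^ 2 - φ z ^ 2 := fun z hz ↦ by
    nlinarith [hnn z hz, h.le z]
  -- With `Λ ^ s = 4`, the target at `Λ x` is `4 ε x ^ s`: a share of `2` pays for `w x ≤ 2 μ ε x ^
  -- s`, the other `2` for the growth from `x` to `Λ x`.
  set Λ : ℝ := 4 ^ (1 / s) with hΛ
  have hΛs : Λ ^ s = 4 := by
    rw [hΛ, ← Real.rpow_mul (by norm_num), one_div_mul_cancel hs0.ne', Real.rpow_one]
  have hΛ1 : 1 < Λ := Real.one_lt_rpow (by norm_num) (by positivity)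
  have hΛ0 : 0 < Λ := one_pos.trans hΛ1
  set A : ℝ := Λ ^ (2 - s) / (c * μ) with hA
  have hA0 : 0 < A := by positivity
  set B : ℝ := 2 * μ * C * b ^ (s - 2) with hB
  have hB0 : 0 < B := by positivity
  set r : ℝ := min (b / 2) (1 / (A * B + 1)) with hr
  have hr0 : 0 < r := lt_min (by positivity) (by positivity)
  have hrb : r ≤ b / 2 := min_le_left _ _
  have hr1 : r ≤ 1 := hrb.trans (by linarith)
  have hrAB : A * B * r ^ (2 - s) ≤ 1 := by
    have h1 : r ^ (2 - s) ≤ r := by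
      calc r ^ (2 - s) ≤ r ^ (1 : ℝ) := Real.rpow_le_rpow_of_exponent_ge hr0 hr1 (by linarith)
        _ = r := Real.rpow_one r
    calc A * B * r ^ (2 - s) ≤ A * B * (1 / (A * B + 1)) := by
          gcongr
          exact h1.trans (min_le_right _ _)
      _ ≤ 1 := by
          rw [mul_one_div, div_le_one (by positivity)]
          linarith
  have hur : 0 < μ - φ (r / Λ) := by
    have : r / Λ ≤ r := div_le_self hr0.le hΛ1.le
    linarith [h.lt_of_mem (x := r / Λ) (by positivity) (by linarith)]
  -- The first entry makes the growth term, quadratic in `ε`, cost at most one unit; the choice of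
  -- `r` does this for the tail term. The second entry produces the contradiction at scale `r`.
  set ε : ℝ := min (3 / A) ((μ - φ (r / Λ)) / (2 * r ^ s)) with hε
  have hε0 : 0 < ε := lt_min (by positivity) (by positivity)
  have hεA : A * ε ≤ 3 := by
    calc A * ε ≤ A * (3 / A) := by gcongr; exact min_le_left _ _
      _ = 3 := by field_simp
  have hεr : ε * r ^ s < μ - φ (r / Λ) := by
    calc ε * r ^ s ≤ (μ - φ (r / Λ)) / (2 * r ^ s) * r ^ s := by gcongr; exact min_le_right _ _
      _ = (μ - φ (r / Λ)) / 2 := by field_simp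
      _ < _ := by linarith
  have step : ∀ x, 0 < x → Λ * x ≤ r → μ - φ x ≤ ε * x ^ s → μ - φ (Λ * x) ≤ ε * (Λ * x) ^ s := by
    intro x hx hxr hux
    have hxy : x ≤ Λ * x := le_mul_of_one_le_left hx.le hΛ1.le
    have hy0 : 0 < Λ * x := by positivity
    have hxb : x ∈ Icc 0 b := ⟨hx.le, by linarith⟩
    have hyb : Λ * x ∈ Icc 0 b := ⟨hy0.le, by linarith⟩
    have h1 := hL _ _ b h.continuous_sq h.abs_sq_le h.sq_even h.sq_nonneg hb1 hmono x (Λ * x) hx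
      hxy (by linarith)
    have h2 := h.eqn x
    set wx := μ ^ 2 - φ x ^ 2
    set wy := μ ^ 2 - φ (Λ * x) ^ 2
    have hu0 : 0 ≤ μ - φ x := by linarith [h.le x]
    have hwx : wx ≤ 2 * μ * (ε * x ^ s) :=
      (sq_sub_sq_le_mul μ (φ x)).trans (mul_le_mul_of_nonneg_left hux (by positivity))
    have hwy : μ * (μ - φ (Λ * x)) ≤ wy := hwlow _ hyb
    have hxs : 0 < x ^ s := by positivity
    have h3 : c * (Λ * x) ^ (s - 2) * (wy - wx) ≤
        ε ^ 2 * (x ^ s) ^ 2 / (3 * x ^ 2) + B * (ε * x ^ s) := by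
      have h4 : (μ - φ x) ^ 2 ≤ ε ^ 2 * (x ^ s) ^ 2 := by
        rw [← mul_pow]
        exact pow_le_pow_left₀ hu0 hux 2
      have h5 : C * b ^ (s - 2) * wx ≤ B * (ε * x ^ s) := by
        calc C * b ^ (s - 2) * wx ≤ C * b ^ (s - 2) * (2 * μ * (ε * x ^ s)) := by gcongr
          _ = _ := by rw [hB]; ring
      have h6 : c * (Λ * x) ^ (s - 2) * (wy - wx) - C * b ^ (s - 2) * wx ≤
          ε ^ 2 * (x ^ s) ^ 2 / (3 * x ^ 2) := by
        rw [le_div_iff₀ (by positivity)]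
        linarith
      linarith
    have h7 : wy - wx ≤ (Λ * x) ^ (2 - s) / c *
        (ε ^ 2 * (x ^ s) ^ 2 / (3 * x ^ 2) + B * (ε * x ^ s)) := by
      have e : (Λ * x) ^ (2 - s) * (Λ * x) ^ (s - 2) = 1 := by
        rw [← Real.rpow_add hy0]
        simp
      calc wy - wx = (Λ * x) ^ (2 - s) / c * (c * (Λ * x) ^ (s - 2) * (wy - wx)) := by
            rw [show (Λ * x) ^ (2 - s) / c * (c * (Λ * x) ^ (s - 2) * (wy - wx)) =
              (Λ * x) ^ (2 - s) * (Λ * x) ^ (s - 2) * (wy - wx) * (c / c) by ring, e,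
              div_self hc.ne']
            ring
        _ ≤ _ := by gcongr
    have h8 : (Λ * x) ^ (2 - s) / c * (ε ^ 2 * (x ^ s) ^ 2 / (3 * x ^ 2) + B * (ε * x ^ s)) =
        μ * (ε * x ^ s) * (A * ε / 3 + A * B * x ^ (2 - s)) := by
      have e : x ^ (2 - s) = x ^ 2 / x ^ s := by
        rw [Real.rpow_sub hx]
        norm_cast
      rw [Real.mul_rpow hΛ0.le hx.le, hA, e]
      field_simp
    have h9 : A * ε / 3 + A * B * x ^ (2 - s) ≤ 2 := by
      have : A * B * x ^ (2 - s) ≤ A * B * r ^ (2 - s) := by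
        have : x ^ (2 - s) ≤ r ^ (2 - s) := Real.rpow_le_rpow hx.le (hxy.trans hxr) (by linarith)
        gcongr
      linarith
    have h10 : μ * (ε * x ^ s) * (A * ε / 3 + A * B * x ^ (2 - s)) ≤ μ * (ε * x ^ s) * 2 := by
      gcongr
    have h11 : μ * (μ - φ (Λ * x)) ≤ μ * (ε * x ^ s * 4) := by linarith
    rw [Real.mul_rpow hΛ0.le hx.le, hΛs]
    have := le_of_mul_le_mul_left h11 hμ
    linarith
  refine ⟨ε, r, hε0, hr0, fun x hx hxr ↦ ?_⟩
  by_contra hcon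
  rw [not_le] at hcon
  have iter : ∀ n : ℕ, Λ ^ n * x ≤ r → μ - φ (Λ ^ n * x) ≤ ε * (Λ ^ n * x) ^ s := by
    intro n
    induction n with
    | zero => intro _; simpa using hcon.le
    | succ n ih =>
      intro hn
      have e : Λ ^ (n + 1) * x = Λ * (Λ ^ n * x) := by ring
      rw [e] at hn ⊢
      have hpos : 0 < Λ ^ n * x := by positivity
      exact step _ hpos hn (ih ((le_mul_of_one_le_left hpos.le hΛ1.le).trans hn))
  obtain ⟨n, hn1, hn2⟩ := exists_nat_pow_near (x := r / x) (y := Λ)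
    ((one_le_div hx).2 hxr) hΛ1
  rw [le_div_iff₀ hx] at hn1
  rw [div_lt_iff₀ hx] at hn2
  have hlow : r / Λ ≤ Λ ^ n * x := by
    rw [div_le_iff₀ hΛ0]
    calc r ≤ Λ ^ (n + 1) * x := hn2.le
      _ = _ := by ring
  have h1 := iter n hn1
  have h2 : μ - φ (r / Λ) ≤ μ - φ (Λ ^ n * x) := by
    have := hanti ⟨by positivity, hlow.trans (by linarith)⟩
      ⟨by positivity, by linarith⟩ hlow
    linarith
  have h3 : ε * (Λ ^ n * x) ^ s ≤ ε * r ^ s := by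
    have := Real.rpow_le_rpow (by positivity) hn1 hs0.le
    gcongr
  linarith

/-- The lower bound at the crest. -/
theorem exists_rpow_le (h : CrestProfile s μ b₀ φ) :
    ∃ c δ : ℝ, 0 < c ∧ 0 < δ ∧ ∀ x, |x| < δ → c * |x| ^ s ≤ μ - φ x := by
  obtain ⟨c, δ, hc, hδ, hle⟩ := h.exists_rpow_le_of_pos
  refine ⟨c, δ, hc, hδ, fun x hx ↦ ?_⟩
  rcases (abs_nonneg x).eq_or_lt with h0 | h0
  · rw [← h0, Real.zero_rpow h.s_pos.ne', mul_zero]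
    linarith [h.le x]
  · have h1 := hle _ h0 hx.le
    rcases abs_choice x with e | e
    · rwa [e] at h1 ⊢
    · rw [e] at h1 ⊢
      rwa [h.even] at h1

/-! ### Hölder continuity of crest profiles -/

/-- The Hölder estimate near the crest. -/
theorem exists_holder_near (h : CrestProfile s μ b₀ φ) :
    ∃ C δ : ℝ, 0 < C ∧ 0 < δ ∧ ∀ x, |x| < δ → ∀ y, |φ x - φ y| ≤ C * |x - y| ^ s := by
  have hs0 := h.s_pos
  have hμ := h.height_pos
  obtain ⟨C₁, hC₁, hup⟩ := h.exists_le_rpow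
  obtain ⟨c, δ, hc, hδ, hlow⟩ := h.exists_rpow_le
  obtain ⟨C, hC, hH⟩ := exists_abs_besselConv_sub_le_of_even hs0 h.s_lt_one
  have hw : ∀ z, |μ ^ 2 - φ z ^ 2| ≤ 2 * μ * C₁ * (|z| ^ s + 0) := fun z ↦ by
    rw [abs_of_nonneg (h.sq_nonneg z), add_zero, mul_assoc]
    exact (sq_sub_sq_le_mul μ (φ z)).trans (mul_le_mul_of_nonneg_left (hup z) (by positivity))
  have hH := hH _ _ _ 0 h.continuous_sq h.abs_sq_le h.sq_even (by positivity) le_rfl hw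
  set C₂ := C₁ * 2 ^ s + C₁ * 3 ^ s
  set C₃ := 3 * (C * (2 * μ * C₁) * 2 ^ s) / c
  refine ⟨C₂ + C₃, δ, by positivity, hδ, fun x hx y ↦ ?_⟩
  have hux : 0 ≤ μ - φ x := by linarith [h.le x]
  have huy : 0 ≤ μ - φ y := by linarith [h.le y]
  have hxys : 0 ≤ |x - y| ^ s := by positivity
  have hC₂ : 0 ≤ C₂ := by positivity
  have hC₃ : 0 ≤ C₃ := by positivity
  -- If `|x|` is at most comparable to `|x - y|`, the upper bound at both points suffices. Otherwise
  -- `|y| ≤ 2 |x|`, and dividing by `u(x) + u(y) ≥ c |x| ^ s`, where `u = μ - φ`, cancels the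
  -- weight.
  rcases le_or_gt |x| (2 * |x - y|) with hcase | hcase
  · have hy : |y| ≤ 3 * |x - y| := by
      have := abs_sub_abs_le_abs_sub y x
      rw [abs_sub_comm y x] at this
      linarith
    have h1 : |x| ^ s ≤ 2 ^ s * |x - y| ^ s := by
      rw [← Real.mul_rpow (by norm_num) (abs_nonneg _)]
      exact Real.rpow_le_rpow (abs_nonneg _) hcase hs0.le
    have h2 : |y| ^ s ≤ 3 ^ s * |x - y| ^ s := by
      rw [← Real.mul_rpow (by norm_num) (abs_nonneg _)]
      exact Real.rpow_le_rpow (abs_nonneg _) hy hs0.le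
    have h3 : |φ x - φ y| ≤ (μ - φ x) + (μ - φ y) := abs_le.2 ⟨by linarith, by linarith⟩
    calc |φ x - φ y| ≤ C₁ * |x| ^ s + C₁ * |y| ^ s := by linarith [hup x, hup y]
      _ ≤ C₁ * (2 ^ s * |x - y| ^ s) + C₁ * (3 ^ s * |x - y| ^ s) := by gcongr
      _ = C₂ * |x - y| ^ s := by ring
      _ ≤ _ := by
        rw [add_mul]
        linarith [mul_nonneg hC₃ hxys]
  · have hx0 : 0 < |x| := lt_of_le_of_lt (by positivity) hcase
    have hy : |y| ≤ 2 * |x| := by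
      have := abs_sub_abs_le_abs_sub y x
      rw [abs_sub_comm y x] at this
      linarith
    have h1 := hH x y (2 * |x|) (by linarith) hy
    rw [add_zero, Real.mul_rpow (by norm_num) (abs_nonneg _)] at h1
    have h2 := h.eqn_sub x y
    have hlx := hlow x hx
    have h3 : |φ x - φ y| * (c * |x| ^ s) ≤
        3 * (C * (2 * μ * C₁) * (2 ^ s * |x| ^ s) * |x - y| ^ s) := by
      calc |φ x - φ y| * (c * |x| ^ s) ≤ |φ x - φ y| * ((μ - φ x) + (μ - φ y)) := by
            gcongr
            linarith
        _ = |(μ - φ x) ^ 2 - (μ - φ y) ^ 2| := by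
            rw [show (μ - φ x) ^ 2 - (μ - φ y) ^ 2 =
              -((φ x - φ y) * ((μ - φ x) + (μ - φ y))) by ring, abs_neg, abs_mul,
              abs_of_nonneg (add_nonneg hux huy)]
        _ ≤ _ := by
            rw [h2, abs_mul, abs_of_pos (by norm_num : (0 : ℝ) < 3)]
            gcongr
    have hxs : 0 < |x| ^ s := by positivity
    have h4 : |φ x - φ y| ≤ C₃ * |x - y| ^ s := by
      rw [← le_div_iff₀ (by positivity)] at h3
      refine h3.trans (le_of_eq ?_)
      simp only [C₃]
      field_simp
    rw [add_mul]
    linarith [mul_nonneg hC₂ hxys]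

/-- The Hölder estimate at points where the profile stays below `μ`. -/
theorem exists_holder_away (h : CrestProfile s μ b₀ φ) {a : ℝ} (ha : 0 < a) :
    ∃ C : ℝ, 0 < C ∧ ∀ x, a ≤ μ - φ x → ∀ y, |φ x - φ y| ≤ C * |x - y| ^ s := by
  have hμ := h.height_pos
  obtain ⟨C, hC, hK⟩ := exists_abs_besselConv_sub_le h.s_pos h.s_lt_one
  refine ⟨3 * (C * μ ^ 2) / a, by positivity, fun x hx y ↦ ?_⟩
  have huy : 0 ≤ μ - φ y := by linarith [h.le y]
  have h1 := hK _ _ h.continuous_sq h.abs_sq_le x y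
  have h2 := h.eqn_sub x y
  rw [div_mul_eq_mul_div, le_div_iff₀ ha]
  calc |φ x - φ y| * a ≤ |φ x - φ y| * ((μ - φ x) + (μ - φ y)) := by
        gcongr
        linarith
    _ = |(μ - φ x) ^ 2 - (μ - φ y) ^ 2| := by
        rw [show (μ - φ x) ^ 2 - (μ - φ y) ^ 2 =
          -((φ x - φ y) * ((μ - φ x) + (μ - φ y))) by ring, abs_neg, abs_mul,
          abs_of_nonneg (add_nonneg (ha.le.trans hx) huy)]
    _ ≤ _ := by
        rw [h2, abs_mul, abs_of_pos (by norm_num : (0 : ℝ) < 3), mul_assoc]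
        gcongr

/-- The global Hölder estimate, for a profile that is determined up to translation by its values on
a set `D` on which it is decreasing. -/
theorem exists_holder (h : CrestProfile s μ b₀ φ) {D : Set ℝ} (hD : Icc 0 b₀ ⊆ D)
    (hanti : AntitoneOn φ D) (hred : ∀ x, ∃ k, (∀ z, φ (z - k) = φ z) ∧ |x - k| ∈ D) :
    ∃ C : ℝ, 0 < C ∧ ∀ x y, |φ x - φ y| ≤ C * |x - y| ^ s := by
  obtain ⟨C₁, δ, hC₁, hδ, hnear⟩ := h.exists_holder_near
  -- Within distance `d` of a crest the local estimate applies; farther away, monotonicity on `D`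
  -- gives `μ - φ ≥ μ - φ d > 0`.
  set d := min δ b₀ with hd
  have hd0 : 0 < d := lt_min hδ h.length_pos
  have hdb : d ≤ b₀ := min_le_right _ _
  have ha : 0 < μ - φ d := by linarith [h.lt_of_mem hd0 hdb]
  obtain ⟨C₂, hC₂, haway⟩ := h.exists_holder_away ha
  refine ⟨C₁ + C₂, by positivity, fun x y ↦ ?_⟩
  have hxys : 0 ≤ |x - y| ^ s := by positivity
  rw [add_mul]
  obtain ⟨k, hk, hkD⟩ := hred x
  rcases lt_or_ge |x - k| d with hcase | hcase
  · have h1 := hnear (x - k) (hcase.trans_le (min_le_left _ _)) (y - k)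
    rw [hk, hk, sub_sub_sub_cancel_right] at h1
    linarith [mul_nonneg hC₂.le hxys]
  · have h1 : φ |x - k| ≤ φ d := hanti (hD ⟨hd0.le, hdb⟩) hkD hcase
    have h2 : φ |x - k| = φ x := by
      rw [← hk x]
      rcases abs_choice (x - k) with e | e <;> rw [e]
      rw [h.even]
    have h3 := haway x (by linarith) y
    linarith [mul_nonneg hC₁.le hxys]

end CrestProfile

theorem memHolderSpace_of_le {α : ℝ} (hα : 0 < α) {f : ℝ → ℝ} {M C : ℝ} (hM : ∀ x, |f x| ≤ M)
    (hC : 0 < C) (h : ∀ x y, |f x - f y| ≤ C * |x - y| ^ α) : MemHolderSpace α f := by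
  refine ⟨Metric.uniformContinuous_iff.2 fun ε hε ↦ ⟨(ε / C) ^ (1 / α), by positivity, ?_⟩,
    ⟨M, hM⟩, ⟨C, h⟩⟩
  intro x y hxy
  rw [Real.dist_eq] at hxy ⊢
  have h1 : |x - y| ^ α < ε / C := by
    calc |x - y| ^ α < ((ε / C) ^ (1 / α)) ^ α :=
          Real.rpow_lt_rpow (abs_nonneg _) hxy hα
      _ = ε / C := by
          rw [← Real.rpow_mul (by positivity), one_div_mul_cancel hα.ne', Real.rpow_one]
  calc |f x - f y| ≤ C * |x - y| ^ α := h x y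
    _ < C * (ε / C) := by gcongr
    _ = ε := by field_simp

/-! ### Solutions of the steady equation -/

theorem besselConv_const_sub {s : ℝ} (hs0 : 0 < s) (hs1 : s < 1) {v : ℝ → ℝ} (hv : Continuous v)
    {M : ℝ} (hM : ∀ x, |v x| ≤ M) (a x : ℝ) : besselConv s (fun z ↦ a - v z) x =
      (∫ y, besselKernel s y) * a - besselConv s v x := by
  have h1 := integrable_besselKernel_mul hs0 hs1 (w := fun y ↦ v (x - y)) (by fun_prop)
    (fun y ↦ hM _)
  rw [besselConv, besselConv, ← integral_mul_const,
    ← integral_sub ((integrable_besselKernel hs0 hs1).mul_const a) h1]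
  refine integral_congr_ae (Filter.Eventually.of_forall fun y ↦ ?_)
  simp only
  ring

theorem besselConv_comp_add_left (s : ℝ) (v : ℝ → ℝ) (a x : ℝ) :
    besselConv s (fun z ↦ v (a + z)) x = besselConv s v (a + x) := by
  simp only [besselConv, add_sub_assoc]

theorem abs_sq_le_norm_sq (φ : ℝ →ᵇ ℝ) (x : ℝ) : |φ x ^ 2| ≤ ‖φ‖ ^ 2 := by
  rw [abs_pow]
  exact pow_le_pow_left₀ (abs_nonneg _) (φ.norm_coe_le_norm x) 2

/-- Completing the square gives `(μ - φ) ^ 2 = μ ^ 2 + 2 κ - 3 K ∗ φ ^ 2`; taking differences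
eliminates `κ`. -/
theorem IsSolution.sq_sub_sq {s μ κ : ℝ} (hs0 : 0 < s) (hs1 : s < 1) {φ : ℝ →ᵇ ℝ}
    (h : IsSolution s μ κ φ) (x y : ℝ) : (μ - φ x) ^ 2 - (μ - φ y) ^ 2 =
      3 * (besselConv s (fun z ↦ φ z ^ 2) y - besselConv s (fun z ↦ φ z ^ 2) x) := by
  have h1 := h.eq_besselConv hs0 hs1 x
  have h2 := h.eq_besselConv hs0 hs1 y
  linarith

theorem IsSolution.crestProfile {s μ κ b₀ : ℝ} (hs0 : 0 < s) (hs1 : s < 1) (hμ : 0 < μ)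
    (hb₀ : 0 < b₀) {φ : ℝ →ᵇ ℝ} (h : IsSolution s μ κ φ) (heven : ∀ x, φ (-x) = φ x)
    (hnonconst : ¬ ∃ c : ℝ, ∀ x : ℝ, φ x = c) (hle : ∀ x, φ x ≤ μ) (hcrest : φ 0 = μ)
    (hanti : AntitoneOn φ (Icc 0 b₀)) (hneg : ∀ x, -μ ≤ φ x) : CrestProfile s μ b₀ φ where
  s_pos := hs0
  s_lt_one := hs1
  height_pos := hμ
  length_pos := hb₀
  continuous := φ.continuous
  even := heven
  le := hle
  neg_le := hneg
  crest := hcrest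
  antitone := hanti
  nonconst := by
    by_contra! hc
    exact hnonconst ⟨μ, hc⟩
  eqn x := by
    have hv : Continuous fun z ↦ φ z ^ 2 := by fun_prop
    rw [besselConv_const_sub hs0 hs1 hv (abs_sq_le_norm_sq φ),
      besselConv_const_sub hs0 hs1 hv (abs_sq_le_norm_sq φ), sub_sub_sub_cancel_left,
      ← h.sq_sub_sq hs0 hs1, hcrest]
    ring

/-! ### The lower bound `-μ` -/

/-- A periodic solution is bounded below by `-μ`: at a deeper trough, the square of the solution
would be maximal and its convolution with the kernel minimal. -/
theorem IsSolution.neg_le_of_periodic {s μ κ T : ℝ} (hs0 : 0 < s) (hs1 : s < 1) (hμ : 0 < μ)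
    (hT : 0 < T) {φ : ℝ →ᵇ ℝ} (h : IsSolution s μ κ φ) (hper : Function.Periodic φ T)
    (heven : ∀ x, φ (-x) = φ x) (hle : ∀ x, φ x ≤ μ) (hcrest : φ 0 = μ)
    (hanti : AntitoneOn φ (Icc 0 (T / 2))) (hmin : ∀ x, φ (T / 2) ≤ φ x) (x : ℝ) :
    -μ ≤ φ x := by
  by_contra! hx
  set m := φ (T / 2) with hm
  have hmμ : m < -μ := (hmin x).trans_lt hx
  have hv : Continuous fun z ↦ φ z ^ 2 := by fun_prop
  have hsq : ∀ z, φ z ^ 2 ≤ m ^ 2 := fun z ↦ by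
    have h1 := hmin z
    have h2 := hle z
    nlinarith
  -- Centred at the trough, `g` is nonnegative, even and zero at `0`. The equation makes its
  -- convolution maximal there, so `g` vanishes identically, although `m ^ 2 > μ ^ 2` at the crest.
  set g : ℝ → ℝ := fun z ↦ m ^ 2 - φ (T / 2 + z) ^ 2 with hg
  have hrefl : ∀ z, φ (T / 2 + z) = φ (T / 2 - z) := fun z ↦ by
    rw [← heven (T / 2 - z), ← hper (-(T / 2 - z))]
    ring_nf
  obtain ⟨b, hb, hbT, hφb⟩ : ∃ b, 0 < b ∧ b ≤ T / 2 ∧ φ (T / 2 - b) ≤ 0 := by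
    have hcont : Continuous fun b ↦ φ (T / 2 - b) := by fun_prop
    have h1 : ∀ᶠ b in nhdsWithin (0 : ℝ) (Ioi 0), φ (T / 2 - b) < 0 :=
      nhdsWithin_le_nhds (hcont.continuousAt.eventually
        (gt_mem_nhds (by simp only [sub_zero]; linarith)))
    obtain ⟨b, hb1, hb2⟩ := (h1.and (Ioc_mem_nhdsGT (half_pos hT))).exists
    exact ⟨b, hb2.1, hb2.2, hb1.le⟩
  have hmono : MonotoneOn g (Icc 0 b) := fun y hy z hz hyz ↦ by
    have hmem : ∀ t ∈ Icc 0 b, T / 2 - t ∈ Icc 0 (T / 2) := fun t ht ↦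
      ⟨by linarith [ht.2], by linarith [ht.1]⟩
    have h1 := hanti (hmem z hz) (hmem y hy) (by linarith)
    have h2 := hanti (hmem b ⟨hb.le, le_rfl⟩) (hmem z hz) (by linarith [hz.2])
    simp only [hg, hrefl]
    nlinarith
  have hconv : ∀ x, besselConv s g x =
      (∫ y, besselKernel s y) * m ^ 2 - besselConv s (fun z ↦ φ z ^ 2) (T / 2 + x) := fun x ↦ by
    have hv' : Continuous fun z ↦ φ (T / 2 + z) ^ 2 := by fun_prop
    rw [hg, besselConv_const_sub hs0 hs1 hv' fun z ↦ abs_sq_le_norm_sq φ _,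
      besselConv_comp_add_left s fun z ↦ φ z ^ 2]
  have hzero := eq_zero_of_besselConv_le hs0 hs1 (w := g) (by fun_prop) (M := m ^ 2)
    (fun z ↦ by
      rw [abs_of_nonneg (sub_nonneg.2 (hsq _))]
      nlinarith [sq_nonneg (φ (T / 2 + z))])
    (fun z ↦ by
      simp only [hg]
      rw [hrefl, sub_neg_eq_add])
    (fun z ↦ sub_nonneg.2 (hsq _)) (by simp [hg, hm]) hb hmono
    (fun y ↦ by
      rw [hconv, hconv, add_zero]
      have h1 := h.sq_sub_sq hs0 hs1 (T / 2) (T / 2 + y)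
      have h2 := hmin (T / 2 + y)
      have h3 := hle (T / 2 + y)
      nlinarith)
    (-(T / 2))
  simp only [hg, add_neg_cancel, hcrest] at hzero
  nlinarith

/-- A solitary solution is bounded below by `-μ`, since its square would otherwise be maximal at
infinity. -/
theorem IsSolution.neg_le_of_antitone {s μ κ : ℝ} (hs0 : 0 < s) (hs1 : s < 1) (hμ : 0 < μ)
    {φ : ℝ →ᵇ ℝ} (h : IsSolution s μ κ φ) (heven : ∀ x, φ (-x) = φ x) (hle : ∀ x, φ x ≤ μ)
    (hcrest : φ 0 = μ) (hanti : AntitoneOn φ (Ici 0)) (x : ℝ) : -μ ≤ φ x := by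
  by_contra! hx
  have habs : ∀ z, φ |z| = φ z := fun z ↦ by
    rcases abs_choice z with e | e <;> rw [e]
    rw [heven]
  have hanti' : Antitone fun z ↦ φ (max z 0) := fun y z hyz ↦
    hanti (mem_Ici.2 (le_max_right _ _)) (mem_Ici.2 (le_max_right _ _)) (max_le_max_right 0 hyz)
  have hbdd : BddBelow (range fun z ↦ φ (max z 0)) :=
    ⟨-‖φ‖, by rintro _ ⟨z, rfl⟩; exact neg_le_of_abs_le (φ.norm_coe_le_norm _)⟩
  set m := ⨅ z, φ (max z 0) with hm
  have hmin : ∀ z, m ≤ φ z := fun z ↦ by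
    have := ciInf_le hbdd |z|
    rwa [max_eq_left (abs_nonneg z), habs] at this
  have hlim : Filter.Tendsto φ Filter.atTop (nhds m) := by
    refine (tendsto_atTop_ciInf hanti' hbdd).congr' ?_
    filter_upwards [Filter.eventually_ge_atTop 0] with z hz
    rw [max_eq_left hz]
  have hmμ : m < -μ := (hmin x).trans_lt hx
  have hsq : ∀ z, φ z ^ 2 ≤ m ^ 2 := fun z ↦ by
    have h1 := hmin z
    have h2 := hle z
    nlinarith
  have hi := integrable_besselKernel hs0 hs1
  have hnorm : ∀ t y, ‖besselKernel s y * φ (t - y) ^ 2‖ ≤ besselKernel s y * m ^ 2 := fun t y ↦ by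
    have hK := besselKernel_nonneg hs0 hs1 y
    rw [Real.norm_of_nonneg (by positivity)]
    exact mul_le_mul_of_nonneg_left (hsq _) hK
  have hmeas : ∀ t, AEStronglyMeasurable (fun y ↦ besselKernel s y * φ (t - y) ^ 2) volume :=
    fun t ↦ (integrable_besselKernel_mul hs0 hs1 (w := fun y ↦ φ (t - y) ^ 2) (by fun_prop)
      fun y ↦ abs_sq_le_norm_sq φ _).aestronglyMeasurable
  have hconv : Filter.Tendsto (besselConv s fun z ↦ φ z ^ 2) Filter.atTop
      (nhds (∫ y, besselKernel s y * m ^ 2)) := by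
    refine tendsto_integral_filter_of_dominated_convergence (fun y ↦ besselKernel s y * m ^ 2)
      (Filter.Eventually.of_forall hmeas)
      (Filter.Eventually.of_forall fun t ↦ Filter.Eventually.of_forall (hnorm t))
      (hi.mul_const _) (Filter.Eventually.of_forall fun y ↦ ?_)
    have : Filter.Tendsto (fun t : ℝ ↦ t - y) Filter.atTop Filter.atTop :=
      Filter.tendsto_atTop_add_const_right _ (-y) Filter.tendsto_id
    exact ((hlim.comp this).pow 2).const_mul _
  have hzero : besselConv s (fun z ↦ φ z ^ 2) 0 ≤ ∫ y, besselKernel s y * m ^ 2 :=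
    (le_abs_self _).trans (norm_integral_le_of_norm_le (hi.mul_const _)
      (Filter.Eventually.of_forall (hnorm 0)))
  have h1 : Filter.Tendsto (fun t ↦ (μ - φ t) ^ 2 - (μ - φ 0) ^ 2) Filter.atTop
      (nhds ((μ - m) ^ 2 - (μ - φ 0) ^ 2)) := ((hlim.const_sub μ).pow 2).sub_const _
  have h2 : Filter.Tendsto (fun t ↦ (μ - φ t) ^ 2 - (μ - φ 0) ^ 2) Filter.atTop
      (nhds (3 * (besselConv s (fun z ↦ φ z ^ 2) 0 - ∫ y, besselKernel s y * m ^ 2))) := by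
    simp only [fun t ↦ h.sq_sub_sq hs0 hs1 t 0]
    exact (hconv.const_sub _).const_mul 3
  -- The limit of the equation is `(μ - m) ^ 2` on one side and, by `hzero`, nonpositive on the
  -- other, while `m < -μ < μ`.
  have h3 := tendsto_nhds_unique h1 h2
  rw [hcrest] at h3
  nlinarith

/-! ### Closed half-periods and reduction modulo the period -/

theorem antitoneOn_Ici_of_leftHalfPeriod_top {φ : ℝ → ℝ} (hφ : Continuous φ)
    (heven : ∀ x, φ (-x) = φ x) (hmono : MonotoneOn φ (leftHalfPeriod ⊤)) :
    AntitoneOn φ (Ici 0) := by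
  have e : leftHalfPeriod ⊤ = Iio 0 := by
    ext x
    have h2 : (⊤ : EReal) / 2 = ⊤ :=
      EReal.top_div_of_pos_ne_top (by norm_num) (EReal.coe_ne_top 2)
    simp [leftHalfPeriod, h2]
  rw [e] at hmono
  have h := hmono.insert_of_continuousWithinAt (x := 0)
    (mem_closure_iff_clusterPt.1 (by simp)) hφ.continuousWithinAt
  rw [Iio_insert] at h
  intro x hx y hy hxy
  rw [← heven x, ← heven y]
  exact h (by simpa using hy) (by simpa using hx) (by linarith)

theorem antitoneOn_Icc_of_leftHalfPeriod_coe {φ : ℝ → ℝ} (hφ : Continuous φ)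
    (heven : ∀ x, φ (-x) = φ x) {T : ℝ} (hT : 0 < T)
    (hmono : MonotoneOn φ (leftHalfPeriod (T : EReal))) : AntitoneOn φ (Icc 0 (T / 2)) := by
  have e : leftHalfPeriod (T : EReal) = Ioo (-(T / 2)) 0 := by
    ext x
    have : -((T : EReal) / 2) = ((-(T / 2) : ℝ) : EReal) := by
      rw [EReal.coe_neg, EReal.coe_div]
      rfl
    simp only [leftHalfPeriod, this, EReal.coe_lt_coe_iff, mem_ofPred_eq, mem_Ioo]
  rw [e] at hmono
  have hlt : -(T / 2) < 0 := by linarith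
  have hcl : closure (Ioo (-(T / 2)) 0) = Icc (-(T / 2)) 0 := closure_Ioo hlt.ne
  have h1 := hmono.insert_of_continuousWithinAt (x := 0)
    (mem_closure_iff_clusterPt.1 (by rw [hcl]; exact right_mem_Icc.2 hlt.le))
    hφ.continuousWithinAt
  rw [Ioo_insert_right hlt] at h1
  have h2 := h1.insert_of_continuousWithinAt (x := -(T / 2))
    (mem_closure_iff_clusterPt.1 (by
      rw [closure_Ioc hlt.ne]; exact left_mem_Icc.2 hlt.le)) hφ.continuousWithinAt
  rw [Ioc_insert_left hlt.le] at h2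
  intro x hx y hy hxy
  rw [← heven x, ← heven y]
  exact h2 ⟨by linarith [hy.2], by linarith [hy.1]⟩ ⟨by linarith [hx.2], by linarith [hx.1]⟩
    (by linarith)

theorem exists_periodic_reduction {φ : ℝ → ℝ} {T : ℝ} (hT : 0 < T)
    (hper : Function.Periodic φ T) (x : ℝ) :
    ∃ k, (∀ z, φ (z - k) = φ z) ∧ |x - k| ∈ Icc 0 (T / 2) := by
  -- The nearest multiple of `T` lies within `T / 2`.
  refine ⟨round (x / T) * T, fun z ↦ hper.sub_int_mul_eq (round (x / T)), abs_nonneg _, ?_⟩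
  have h1 := abs_sub_round (x / T)
  have h2 : x - round (x / T) * T = (x / T - round (x / T)) * T := by
    rw [sub_mul, div_mul_cancel₀ x hT.ne']
  rw [h2, abs_mul, abs_of_pos hT]
  nlinarith

end SteadyFDP

end

theorem theorem4p6 (s κ μ : ℝ) (hs0 : 0 < s) (hs1 : s < 1) (hμ : 0 < μ)
    (P : EReal) (hP : 0 < P) (φ : ℝ →ᵇ ℝ)
    (hsol : SteadyFDP.IsSolution s μ κ φ)
    (hper : SteadyFDP.IsPeriodic P φ)
    (heven : ∀ x : ℝ, φ (-x) = φ x)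
    (hnonconst : ¬ ∃ c : ℝ, ∀ x : ℝ, φ x = c)
    (hmono : MonotoneOn φ (SteadyFDP.leftHalfPeriod P))
    (hle : ∀ x : ℝ, φ x ≤ μ)
    (hcrest : φ 0 = μ) :
    SteadyFDP.MemHolderSpace s φ ∧
      ∃ c C δ : ℝ, 0 < c ∧ 0 < C ∧ 0 < δ ∧
        ∀ x : ℝ, |x| < δ → c * |x| ^ s ≤ μ - φ x ∧ μ - φ x ≤ C * |x| ^ s := by
  -- `D` is a closed half-period or half-line on which `φ` decreases, and it determines `φ` up to
  -- translation and reflection. This treats the periodic and solitary cases together.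
  obtain ⟨b₀, D, h, hD, hanti, hred⟩ : ∃ (b₀ : ℝ) (D : Set ℝ),
      SteadyFDP.CrestProfile s μ b₀ φ ∧ Set.Icc 0 b₀ ⊆ D ∧ AntitoneOn φ D ∧
        ∀ x, ∃ k, (∀ z, φ (z - k) = φ z) ∧ |x - k| ∈ D := by
    induction P with
    | bot => exact absurd hP (by simp)
    | top =>
      have hanti := SteadyFDP.antitoneOn_Ici_of_leftHalfPeriod_top φ.continuous heven hmono
      have hanti₁ : AntitoneOn φ (Set.Icc 0 1) := hanti.mono Set.Icc_subset_Ici_self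
      -- On the half-line the length `1` is arbitrary, and no translation is needed.
      exact ⟨1, Set.Ici 0, hsol.crestProfile hs0 hs1 hμ one_pos heven hnonconst hle hcrest hanti₁
        (hsol.neg_le_of_antitone hs0 hs1 hμ heven hle hcrest hanti), Set.Icc_subset_Ici_self,
        hanti, fun x ↦ ⟨0, by simp, by simp⟩⟩
    | coe T =>
      have hT : 0 < T := EReal.coe_pos.1 hP
      have hper := hper T rfl
      have hanti := SteadyFDP.antitoneOn_Icc_of_leftHalfPeriod_coe φ.continuous heven hT hmono
      have hred := SteadyFDP.exists_periodic_reduction hT hper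
      have hmin : ∀ x, φ (T / 2) ≤ φ x := fun x ↦ by
        obtain ⟨k, hk, hx⟩ := hred x
        have h1 := hanti hx ⟨by positivity, le_rfl⟩ hx.2
        have h2 : φ |x - k| = φ x := by
          rw [← hk x]
          rcases abs_choice (x - k) with e | e <;> rw [e]
          rw [heven]
        rwa [h2] at h1
      exact ⟨T / 2, Set.Icc 0 (T / 2), hsol.crestProfile hs0 hs1 hμ (half_pos hT) heven hnonconst
        hle hcrest hanti (hsol.neg_le_of_periodic hs0 hs1 hμ hT hper heven hle hcrest hanti hmin),
        subset_rfl, hanti, hred⟩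
  obtain ⟨H, hH, hholder⟩ := h.exists_holder hD hanti hred
  obtain ⟨C, hC, hup⟩ := h.exists_le_rpow
  obtain ⟨c, δ, hc, hδ, hlow⟩ := h.exists_rpow_le
  exact ⟨SteadyFDP.memHolderSpace_of_le hs0 φ.norm_coe_le_norm hH hholder,
    c, C, δ, hc, hC, hδ, fun x hx ↦ ⟨hlow x hx, hup x⟩⟩
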